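/- Let $(N,g)$ be a closed connected Riemannian manifold with universal covering $\pi:\widetilde N\to N$, let $U:N\to\mathbb R$ be smooth, and let $\sigma$ be a smooth closed 2-form on $N$. Put $H_U(q,p)=\tfrac12|p|_g^2+U(q)$ on $T^*N$, let $\tau:T^*N\to N$ be the projection, and let $\omega_\sigma=dp\wedge dq+\tau^*\sigma$ be the twisted symplectic form. The Mañé critical value is $$c=c(g,\sigma,U)=\inf_{\theta}\ \sup_{x\in\widetilde N}\widetilde H_U(x,\theta_x)\in(-\infty,\infty],$$ where $\theta$ runs through the smooth 1-forms on $\widetilde N$ with $d\theta=\pi^*\sigma$ and $\widetilde H_U$ is the lift of $H_U$ to $T^*\widetilde N$ ($c=\infty$ if no $\theta$ has finite supremum). Let $k\in\mathbb R$ with $k>c$ (so that, in particular, $\sigma$ is weakly exact), let $\xi>0$ and $\epsilon_\xi=\min\{1/3,\xi/3\}$, and let $\beta:\mathbb R\to\mathbb R$ be smooth with $0\le\dot\beta\le1$, $\beta(t)=t$ for $|t|\le\xi-\epsilon_\xi$, $\beta(t)=\xi$ for $t\ge\xi+\epsilon_\xi$ and $\beta(t)=-\xi$ for $t\le-\xi-\epsilon_\xi$.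 Let $H=\beta\circ(H_U-k)$ be the resulting defining Hamiltonian of $\Sigma_k=H^{-1}(0)=H_U^{-1}(k)$, let $X_H$ be its Hamiltonian vector field, $\iota_{X_H}\omega_\sigma=-dH$, and let $(J_t)_{t\in S^1}$, $S^1=\mathbb R/\mathbb Z$, be a smooth family of almost complex structures on $T^*N$ such that every $\omega_\sigma(\cdot,J_t\cdot)$ is a Riemannian metric. For a free homotopy class $\nu$ of loops in $T^*N$ with a fixed smooth reference loop $v_\nu$, for a smooth loop $v:S^1\to T^*N$ in the class $\nu$ and for $\eta\in\mathbb R$, the Rabinowitz action functional is $$\mathcal A(v,\eta)=\int_{D}\overline v^*\omega_\sigma-\eta\int_0^1H(v(t))\,dt,$$ where $\overline v:D=S^1\times[0,1]\to T^*N$ is any smooth map with $\overline v(t,0)=v_\nu(t)$, $\overline v(t,1)=v(t)$, and $D$ is oriented so that the boundary circle carrying $v$ is positively and the one carrying $v_\nu$ negatively oriented. Its gradient with respect to the $L^2$-metric $\int_0^1\omega_\sigma(\xi_1,J_t(v)\xi_2)\,dt+h_1h_2$ is $$\nabla\mathcal A(v,\eta)=\Big(-J_t(v)\big(\partial_tv-\eta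 X_H(v)\big),\ -\int_0^1H(v(t))\,dt\Big),$$ and $\|\nabla\mathcal A(v,\eta)\|$ denotes its norm in this metric. Then there is a constant $\varepsilon>0$, and for every free homotopy class $\nu$ with reference loop $v_\nu$ there is a constant $\overline c<\infty$, such that for all smooth loops $v$ in the class $\nu$ and all $\eta\in\mathbb R$ (and for every choice of $\overline v$) $$\|\nabla\mathcal A(v,\eta)\|\le\varepsilon\ \Longrightarrow\ |\eta|\le\overline c\,\big(|\mathcal A(v,\eta)|+1\big).$$ -/

import Mathlib

open Manifold Bundle Set
open scoped ContDiff

noncomputable section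

namespace Rabinowitz

section Forms

/-! Differential forms on a smooth manifold without boundary. -/

variable {E : Type*} [NormedAddCommGroup E] [NormedSpace ℝ E]
  {H : Type*} [TopologicalSpace H] (I : ModelWithCorners ℝ E H)
  {M : Type*} [TopologicalSpace M] [ChartedSpace H M]
  {E' : Type*} [NormedAddCommGroup E'] [NormedSpace ℝ E']
  {H' : Type*} [TopologicalSpace H'] (I' : ModelWithCorners ℝ E' H')
  {M' : Type*} [TopologicalSpace M'] [ChartedSpace H' M']

/-- A (not necessarily smooth) differential `k`-form on `M`: an alternating `k`-linear form on
every tangent space. -/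
abbrev DiffForm (M : Type*) [TopologicalSpace M] [ChartedSpace H M] (k : ℕ) : Type _ :=
  ∀ x : M, TangentSpace I x [⋀^Fin k]→L[ℝ] ℝ

variable {I I'} in
/-- The pullback `f^* α` of a differential form. -/
def pullback {k : ℕ} (f : M → M') (α : DiffForm I' M' k) : DiffForm I M k :=
  fun x => (α (f x)).compContinuousLinearMap (mfderiv I I' f x)

variable {I} in
/-- The form `α` read in the preferred chart around `x₀`, that is, its pullback under the inverse
of the chart. It is meaningful on the (open) target of the chart. -/
def inChart {k : ℕ} (α : DiffForm I M k) (x₀ : M) : E → E [⋀^Fin k]→L[ℝ] ℝ :=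
  pullback (I := 𝓘(ℝ, E)) (I' := I) (extChartAt I x₀).symm α

variable {I} in
/-- Smoothness of a differential form: its coefficients are smooth in every chart. -/
def SmoothForm {k : ℕ} (α : DiffForm I M k) : Prop :=
  ∀ x₀ : M, ContDiffOn ℝ ∞ (inChart α x₀) (extChartAt I x₀).target

variable {I} in
/-- The exterior derivative of a differential form, computed in a chart around each point. -/
def extD {k : ℕ} (α : DiffForm I M k) : DiffForm I M (k + 1) := fun x =>
  (extDeriv (inChart α x) (extChartAt I x x)).compContinuousLinearMap
    (mfderiv I 𝓘(ℝ, E) (extChartAt I x) x)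

end Forms

section Symplectic

/-! Hamiltonian dynamics and the Rabinowitz action functional for a 2-form `Ω` on a manifold `M`. -/

variable {E : Type*} [NormedAddCommGroup E] [NormedSpace ℝ E]
  {H : Type*} [TopologicalSpace H] {I : ModelWithCorners ℝ E H}
  {M : Type*} [TopologicalSpace M] [ChartedSpace H M]

open Classical in
/-- The Hamiltonian vector field `X_F` of `F` with respect to `Ω`, that is, the vector field with
`ι_{X_F} Ω = - dF` (for a nondegenerate form `Ω` on a finite-dimensional manifold it exists and is
unique). For `Ω = dp ∧ dq` this is `q' = ∂F/∂p`, `p' = - ∂F/∂q`. -/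
def hamVF (Ω : DiffForm I M 2) (F : M → ℝ) (x : M) : TangentSpace I x :=
  if h : ∃ X : TangentSpace I x, ∀ w : TangentSpace I x, Ω x ![X, w] = -(mfderiv I 𝓘(ℝ, ℝ) F x w : ℝ)
  then h.choose else 0

/-- A smooth family `J_t`, `t ∈ ℝ/ℤ`, of `Ω`-compatible almost complex structures: `J_t² = -1`,
and `Ω(·, J_t ·)` is a Riemannian metric. -/
structure IsCompatibleFamily [IsManifold I ∞ M] (Ω : DiffForm I M 2)
    (J : ℝ → ∀ x : M, TangentSpace I x →L[ℝ] TangentSpace I x) : Prop where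
  smooth : ContMDiff (𝓘(ℝ, ℝ).prod I) (I.prod 𝓘(ℝ, E →L[ℝ] E)) ∞
    (fun z : ℝ × M => (TotalSpace.mk' (E →L[ℝ] E) z.2 (J z.1 z.2) :
      TotalSpace (E →L[ℝ] E) (fun x : M => TangentSpace I x →L[ℝ] TangentSpace I x)))
  periodic : Function.Periodic J 1
  sq : ∀ t x (u : TangentSpace I x), J t x (J t x u) = -u
  symm : ∀ t x (u w : TangentSpace I x), Ω x ![u, J t x w] = Ω x ![w, J t x u]
  pos : ∀ t x (u : TangentSpace I x), u ≠ 0 → 0 < Ω x ![u, J t x u]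

variable (I) in
/-- A smooth loop `S¹ = ℝ/ℤ → M`, as a smooth 1-periodic map on `ℝ`. -/
def IsLoop (v : ℝ → M) : Prop := ContMDiff 𝓘(ℝ, ℝ) I ∞ v ∧ Function.Periodic v 1

variable (I) in
/-- `vbar` is a smooth map on the cylinder `D = S¹ × [0,1] ∋ (t, s)` whose restriction to the
boundary circle `s = 0` is `v₀` and whose restriction to the boundary circle `s = 1` is `v₁`
(smooth on the closed cylinder, i.e. given with a smooth extension to `S¹ × ℝ`). -/
structure IsCylinder (v₀ v₁ : ℝ → M) (vbar : ℝ × ℝ → M) : Prop where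
  smooth : ContMDiff 𝓘(ℝ, ℝ × ℝ) I ∞ vbar
  periodic : ∀ t s, vbar (t + 1, s) = vbar (t, s)
  left : ∀ t, vbar (t, 0) = v₀ t
  right : ∀ t, vbar (t, 1) = v₁ t

/-- The integral `∫_D vbar^* Ω`. The orientation of `D` is the one for which `s = 1` is a positively
and `s = 0` a negatively oriented boundary circle. -/
def cylinderIntegral (Ω : DiffForm I M 2) (vbar : ℝ × ℝ → M) : ℝ :=
  ∫ s in (0 : ℝ)..1, ∫ t in (0 : ℝ)..1,
    Ω (vbar (t, s)) ![mfderiv 𝓘(ℝ, ℝ × ℝ) I vbar (t, s) ((0, 1) : ℝ × ℝ),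
      mfderiv 𝓘(ℝ, ℝ × ℝ) I vbar (t, s) ((1, 0) : ℝ × ℝ)]

/-- The Rabinowitz action `A(v, η) = ∫_D vbar^* Ω - η ∫₀¹ F(v(t)) dt`, where `vbar` is a cylinder
from the reference loop of the free homotopy class of `v` to `v`. -/
def action (Ω : DiffForm I M 2) (F : M → ℝ) (vbar : ℝ × ℝ → M) (v : ℝ → M) (η : ℝ) : ℝ :=
  cylinderIntegral Ω vbar - η * ∫ t in (0 : ℝ)..1, F (v t)

variable (I) in
/-- The velocity `∂_t v`. -/
def velocity (v : ℝ → M) (t : ℝ) : TangentSpace I (v t) := mfderiv 𝓘(ℝ, ℝ) I v t (1 : ℝ)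

/-- The `L²`-metric `∫₀¹ Ω(ξ₁, J_t(v) ξ₂) dt + h₁ h₂` on the tangent space at `(v, η)` of the
product of the loop space with `ℝ`. -/
def l2Inner (Ω : DiffForm I M 2) (J : ℝ → ∀ x : M, TangentSpace I x →L[ℝ] TangentSpace I x)
    (v : ℝ → M) (a b : (∀ t : ℝ, TangentSpace I (v t)) × ℝ) : ℝ :=
  (∫ t in (0 : ℝ)..1, Ω (v t) ![a.1 t, J t (v t) (b.1 t)]) + a.2 * b.2

/-- The `L²`-gradient of the Rabinowitz action functional at `(v, η)`:
`(- J_t(v) (∂_t v - η X_F(v)), - ∫₀¹ F(v(t)) dt)`. With respect to the `L²`-metric it represents the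
differential `(ξ, h) ↦ ∫₀¹ Ω(ξ, ∂_t v - η X_F(v)) dt - h ∫₀¹ F(v(t)) dt` of the functional. -/
def gradAction (Ω : DiffForm I M 2) (J : ℝ → ∀ x : M, TangentSpace I x →L[ℝ] TangentSpace I x)
    (F : M → ℝ) (v : ℝ → M) (η : ℝ) : (∀ t : ℝ, TangentSpace I (v t)) × ℝ :=
  (fun t => -(J t (v t) (velocity I v t - η • hamVF Ω F (v t))), -∫ t in (0 : ℝ)..1, F (v t))

/-- The `L²`-norm of the gradient. -/
def gradNorm (Ω : DiffForm I M 2) (J : ℝ → ∀ x : M, TangentSpace I x →L[ℝ] TangentSpace I x)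
    (F : M → ℝ) (v : ℝ → M) (η : ℝ) : ℝ :=
  Real.sqrt (l2Inner Ω J v (gradAction Ω J F v η) (gradAction Ω J F v η))

end Symplectic

section Cotangent

/-! Twisted cotangent bundles. The base `N` is modelled on `ℝⁿ`. -/

variable {n : ℕ} {N : Type*} [TopologicalSpace N] [ChartedSpace (EuclideanSpace ℝ (Fin n)) N]
  [IsManifold (𝓡 n) ∞ N]

/-- The model vector space of a cotangent fibre. -/
abbrev CoModel (n : ℕ) : Type := EuclideanSpace ℝ (Fin n) →L[ℝ] ℝ

/-- The cotangent bundle `T^*N`, as the bundle of continuous linear forms on the tangent bundle,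
with its standard smooth structure. -/
abbrev Cotangent (n : ℕ) (N : Type*) [TopologicalSpace N]
    [ChartedSpace (EuclideanSpace ℝ (Fin n)) N] [IsManifold (𝓡 n) ∞ N] : Type _ :=
  TotalSpace (CoModel n) (fun q : N => TangentSpace (𝓡 n) q →L[ℝ] Bundle.Trivial N ℝ q)

/-- The model with corners of `T^*N`. -/
abbrev coI (n : ℕ) := (𝓡 n).prod 𝓘(ℝ, CoModel n)

/-- The covector `p ∈ T_q^*N` underlying a point `(q, p)` of `T^*N`. -/
def momentum (x : Cotangent n N) : TangentSpace (𝓡 n) x.proj →L[ℝ] ℝ := x.snd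

variable (n N) in
/-- The footpoint projection `τ : T^*N → N`. -/
def footpoint (x : Cotangent n N) : N := x.proj

variable (n N) in
/-- The Liouville form `p dq`. -/
def liouville : DiffForm (coI n) (Cotangent n N) 1 := fun x =>
  ContinuousAlternatingMap.ofSubsingleton ℝ _ ℝ (0 : Fin 1)
    ((momentum x).comp (mfderiv (coI n) (𝓡 n) (footpoint n N) x))

/-- The twisted symplectic form `ω_σ = dp ∧ dq + τ^*σ`, where `dp ∧ dq = d(p dq)`. -/
def twistedForm (σ : DiffForm (𝓡 n) N 2) : DiffForm (coI n) (Cotangent n N) 2 :=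
  extD (liouville n N) + pullback (footpoint n N) σ

/-- The dual norm `|p|` of a covector `p ∈ T_q^*N` with respect to the Riemannian metric `g`. -/
def dualNorm (g : ContMDiffRiemannianMetric (𝓡 n) ∞ (EuclideanSpace ℝ (Fin n))
    (fun q : N => TangentSpace (𝓡 n) q)) (q : N) (p : TangentSpace (𝓡 n) q →L[ℝ] ℝ) : ℝ :=
  sSup {r : ℝ | ∃ u : TangentSpace (𝓡 n) q, g.inner q u u ≤ 1 ∧ r = p u}

/-- The mechanical Hamiltonian `H_U(q, p) = |p|²/2 + U(q)`, as a function of `q` and `p`. -/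
def mechanical (g : ContMDiffRiemannianMetric (𝓡 n) ∞ (EuclideanSpace ℝ (Fin n))
    (fun q : N => TangentSpace (𝓡 n) q)) (U : N → ℝ) (q : N)
    (p : TangentSpace (𝓡 n) q →L[ℝ] ℝ) : ℝ :=
  dualNorm g q p ^ 2 / 2 + U q

/-- The cut-off function `β_ξ`. -/
structure IsCutoff (ξ : ℝ) (β : ℝ → ℝ) : Prop where
  smooth : ContDiff ℝ ∞ β
  deriv_mem : ∀ t, deriv β t ∈ Icc (0 : ℝ) 1
  eq_self : ∀ t, |t| ≤ ξ - min (1 / 3) (ξ / 3) → β t = t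
  eq_top : ∀ t, ξ + min (1 / 3) (ξ / 3) ≤ t → β t = ξ
  eq_bot : ∀ t, ξ + min (1 / 3) (ξ / 3) ≤ -t → β t = -ξ

/-- The defining Hamiltonian `H = β_ξ ∘ (H_U - k)` of the hypersurface `Σ_k = H_U⁻¹(k)`. -/
def definingHamiltonian (g : ContMDiffRiemannianMetric (𝓡 n) ∞ (EuclideanSpace ℝ (Fin n))
    (fun q : N => TangentSpace (𝓡 n) q)) (U : N → ℝ) (k : ℝ) (β : ℝ → ℝ)
    (x : Cotangent n N) : ℝ :=
  β (mechanical g U x.proj (momentum x) - k)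

variable {N' : Type*} [TopologicalSpace N'] [ChartedSpace (EuclideanSpace ℝ (Fin n)) N']

/-- `pr : N' → N` is a smooth universal covering. -/
structure IsUniversalCovering (n : ℕ) {N : Type*} [TopologicalSpace N]
    [ChartedSpace (EuclideanSpace ℝ (Fin n)) N] {N' : Type*} [TopologicalSpace N']
    [ChartedSpace (EuclideanSpace ℝ (Fin n)) N'] (pr : N' → N) : Prop where
  simplyConnected : SimplyConnectedSpace N'
  covering : IsCoveringMap pr
  localDiffeo : IsLocalDiffeomorph (𝓡 n) (𝓡 n) ∞ pr

/-- The lift of `H_U` to the universal covering: `H̃_U(x, a)` is the value of `H_U` at `pr x` and the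
covector `a ∘ (dpr_x)⁻¹` that corresponds to `a` under the local diffeomorphism `pr`. -/
def liftedMechanical (g : ContMDiffRiemannianMetric (𝓡 n) ∞ (EuclideanSpace ℝ (Fin n))
    (fun q : N => TangentSpace (𝓡 n) q)) (U : N → ℝ) (pr : N' → N) (x : N')
    (a : TangentSpace (𝓡 n) x →L[ℝ] ℝ) : ℝ :=
  mechanical g U (pr x) (a.comp (mfderiv (𝓡 n) (𝓡 n) pr x).inverse)

/-- The Mañé critical value `c(g, σ, U) = inf_θ sup_x H̃_U(x, θ_x)`, where `θ` runs through the smooth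
primitives of `pr^*σ` on the universal covering. It is an extended real number, equal to `⊤` if
there is no primitive with finite supremum. -/
def maneCriticalValue (g : ContMDiffRiemannianMetric (𝓡 n) ∞ (EuclideanSpace ℝ (Fin n))
    (fun q : N => TangentSpace (𝓡 n) q)) (σ : DiffForm (𝓡 n) N 2) (U : N → ℝ) (pr : N' → N) :
    EReal :=
  ⨅ θ ∈ {θ : DiffForm (𝓡 n) N' 1 | SmoothForm θ ∧ extD θ = pullback pr σ},
    ⨆ x : N', ((liftedMechanical g U pr x
      ((ContinuousAlternatingMap.ofSubsingleton ℝ (TangentSpace (𝓡 n) x) ℝ (0 : Fin 1)).symm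
        (θ x)) : ℝ) : EReal)

end Cotangent

end Rabinowitz

end

noncomputable section

open Filter Topology MeasureTheory

set_option linter.unusedSectionVars false

namespace Rabinowitz

/-! ### Differential forms in charts and pullbacks to normed spaces -/

section FormCalculus

variable {E : Type*} [NormedAddCommGroup E] [NormedSpace ℝ E]
  {H : Type*} [TopologicalSpace H] {I : ModelWithCorners ℝ E H} [I.Boundaryless]
  {M : Type*} [TopologicalSpace M] [ChartedSpace H M] [IsManifold I ∞ M]
  {F : Type*} [NormedAddCommGroup F] [NormedSpace ℝ F]

/-! Since `k` exceeds the Mañé value, there are `k₀ < k` and a primitive `θ` of the lift of `σ` to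
the universal covering with energy at most `k₀` everywhere. Then `p dq + θ` is a primitive of the
lift of `ω_σ`. At a point `(q, p)` where the cut-off is locally the identity, the Hamiltonian vector
field projects to the vector dual to `p`. On it the primitive has the value `|p|² + ⟨a, p⟩ ≥ (|p|² -
|a|²)/2`, where `a` is the covector of `θ` (`dualNorm_sq_sub_le`). This is the energy difference of
`p` and `a`, hence at least `δ = (k - k₀)/2` near `Σ_k` (`le_covector_apply`).

A small gradient forces the loop to stay near `Σ_k` (`abs_comp_loop_le`). The mean of `H` is small
by the second component of the gradient. Its oscillation is small because `dH(X_H) = 0`, so that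
only `∂_t v - η X_H` contributes to the derivative of `H ∘ v`. Everything is compared with the
`J_t`-norms on compact energy sublevels, where the comparison is uniform
(`IsCompatibleFamily.exists_forall_le`).

The loop need not lift to a closed loop, and `θ` need not be invariant under deck transformations,
so Stokes' theorem on the cylinder leaves the two sides of a cut. The remedy is averaging. The
cylinder is unrolled to the plane, which always lifts (`IsUniversalCovering.exists_primitive`), and
Stokes is applied on `[0, m] × [0, 1]` (`IsCylinder.integral_primitive`). The cut terms are bounded
independently of `m`, because `θ` is bounded and the cylinder is periodic. All other contributions
grow at most linearly, so dividing by `m` and letting `m → ∞` removes the cut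
(`IsCylinder.le_abs_cylinderIntegral`). What remains is `|η| δ ≤ |∫ ω_σ| + const`, with a constant
independent of the cylinder. Since the area differs from the action by at most `|η| ε` and `ε ≤
δ/2`, this term is absorbed on the left. -/

theorem mfderiv_extChartAt_symm_apply {x₀ x : M} (hx : x ∈ (extChartAt I x₀).source)
    (w : TangentSpace I x) :
    (mfderiv 𝓘(ℝ, E) I (extChartAt I x₀).symm (extChartAt I x₀ x)
      (mfderiv I 𝓘(ℝ, E) (extChartAt I x₀) x w : E) : E) = (w : E) := by
  have h := mfderivWithin_extChartAt_symm_comp_mfderiv_extChartAt' (I := I) hx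
  rw [I.range_eq_univ, mfderivWithin_univ] at h
  exact DFunLike.congr_fun h w

theorem mfderiv_extChartAt_apply_symm {x₀ : M} {y : E} (hy : y ∈ (extChartAt I x₀).target) (u : E) :
    (mfderiv I 𝓘(ℝ, E) (extChartAt I x₀) ((extChartAt I x₀).symm y)
      (mfderiv 𝓘(ℝ, E) I (extChartAt I x₀).symm y u) : E) = u := by
  have h := mfderiv_extChartAt_comp_mfderivWithin_extChartAt_symm (I := I) hy
  rw [I.range_eq_univ, mfderivWithin_univ] at h
  exact DFunLike.congr_fun h u

variable (I) in
/-- The coordinates of a tangent vector at `x` in the chart around `x₀`. -/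
def chartDeriv (x₀ x : M) : TangentSpace I x →L[ℝ] E :=
  mfderiv I 𝓘(ℝ, E) (extChartAt I x₀) x

variable (I) in
/-- The tangent vector with given coordinates in the chart around `x₀`. -/
def chartDerivSymm (x₀ x : M) : E →L[ℝ] TangentSpace I x :=
  mfderiv 𝓘(ℝ, E) I (extChartAt I x₀).symm (extChartAt I x₀ x)

theorem chartDerivSymm_chartDeriv {x₀ x : M} (hx : x ∈ (extChartAt I x₀).source)
    (w : TangentSpace I x) : chartDerivSymm I x₀ x (chartDeriv I x₀ x w) = w :=
  mfderiv_extChartAt_symm_apply hx w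

theorem chartDeriv_chartDerivSymm {x₀ x : M} (hx : x ∈ (extChartAt I x₀).source) (u : E) :
    chartDeriv I x₀ x (chartDerivSymm I x₀ x u) = u := by
  have h := mfderiv_extChartAt_apply_symm ((extChartAt I x₀).map_source hx) u
  rw [(extChartAt I x₀).left_inv hx] at h
  exact h

/-- A form evaluated through its expression in a chart. -/
theorem form_apply_eq_inChart {k : ℕ} (α : DiffForm I M k) {x₀ x : M}
    (hx : x ∈ (extChartAt I x₀).source) (w : Fin k → TangentSpace I x) :
    α x w = inChart α x₀ (extChartAt I x₀ x)
      (fun i => chartDeriv I x₀ x (w i)) := by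
  -- The chart followed by its inverse returns `x` only propositionally; the forms at the two base
  -- points are compared on the common model space `E`.
  have key : ∀ y, y = x → (α y : E [⋀^Fin k]→L[ℝ] ℝ) = (α x : E [⋀^Fin k]→L[ℝ] ℝ) := by
    rintro _ rfl; rfl
  change _ = (α ((extChartAt I x₀).symm (extChartAt I x₀ x)) : E [⋀^Fin k]→L[ℝ] ℝ)
    (fun i => (mfderiv 𝓘(ℝ, E) I (extChartAt I x₀).symm (extChartAt I x₀ x)
      (mfderiv I 𝓘(ℝ, E) (extChartAt I x₀) x (w i) : E) : E))
  rw [key _ ((extChartAt I x₀).left_inv hx)]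
  simp_rw [mfderiv_extChartAt_symm_apply hx]
  rfl

theorem two_form_apply_eq_inChart (α : DiffForm I M 2) {x₀ x : M}
    (hx : x ∈ (extChartAt I x₀).source) (u w : TangentSpace I x) :
    α x ![u, w] = inChart α x₀ (extChartAt I x₀ x) ![chartDeriv I x₀ x u, chartDeriv I x₀ x w] := by
  rw [form_apply_eq_inChart α hx]
  congr 1
  ext1 i
  fin_cases i <;> rfl

theorem mdifferentiableAt_extChartAt_of_mem {x₀ x : M} (hx : x ∈ (extChartAt I x₀).source) :
    MDifferentiableAt I 𝓘(ℝ, E) (extChartAt I x₀) x :=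
  mdifferentiableAt_extChartAt (by rwa [extChartAt_source] at hx)

/-- The derivative of a map read in a chart of the target. -/
theorem fderiv_extChartAt_comp {f : F → M} {z : F} {x₀ : M}
    (hf : MDifferentiableAt 𝓘(ℝ, F) I f z) (hx : f z ∈ (extChartAt I x₀).source) (u : F) :
    fderiv ℝ (fun z => extChartAt I x₀ (f z)) z u =
      chartDeriv I x₀ (f z) (mfderiv 𝓘(ℝ, F) I f z u) := by
  have h := mfderiv_comp z (mdifferentiableAt_extChartAt_of_mem hx) hf
  rw [mfderiv_eq_fderiv] at h
  exact DFunLike.congr_fun h u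

theorem contDiffAt_extChartAt_comp {f : F → M} {z : F} {x₀ : M}
    (hf : ContMDiffAt 𝓘(ℝ, F) I ∞ f z) (hx : f z ∈ (extChartAt I x₀).source) :
    ContDiffAt ℝ ∞ (fun z => extChartAt I x₀ (f z)) z := by
  rw [← contMDiffAt_iff_contDiffAt]
  refine ContMDiffAt.comp z (contMDiffAt_extChartAt' ?_) hf
  rwa [extChartAt_source] at hx

/-- The pullback of a form to a normed space. -/
def flatPullback {k : ℕ} (f : F → M) (α : DiffForm I M k) : F → F [⋀^Fin k]→L[ℝ] ℝ :=
  pullback (I := 𝓘(ℝ, F)) f α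

/-- The pullback of a form in terms of its expression in a chart. -/
theorem pullback_eventuallyEq_inChart {k : ℕ} (α : DiffForm I M k) {f : F → M} {z : F} {x₀ : M}
    (hf : ContMDiffAt 𝓘(ℝ, F) I ∞ f z) (hx : f z ∈ (extChartAt I x₀).source) :
    (flatPullback f α) =ᶠ[𝓝 z]
      fun z => (inChart α x₀ (extChartAt I x₀ (f z))).compContinuousLinearMap
        (fderiv ℝ (fun z => extChartAt I x₀ (f z)) z) := by
  have h1 : ∀ᶠ z' in 𝓝 z, ContMDiffAt 𝓘(ℝ, F) I 1 f z' :=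
    (contMDiffAt_iff_contMDiffAt_nhds (by simp)).1 (hf.of_le (by simp))
  have h2 : ∀ᶠ z' in 𝓝 z, f z' ∈ (extChartAt I x₀).source :=
    hf.continuousAt.preimage_mem_nhds ((isOpen_extChartAt_source x₀).mem_nhds hx)
  filter_upwards [h1, h2] with z' hz1 hz2
  ext w
  have hd := hz1.mdifferentiableAt (by simp)
  refine (form_apply_eq_inChart α hz2 (fun i => mfderiv 𝓘(ℝ, F) I f z' (w i))).trans ?_
  exact congrArg (inChart α x₀ (extChartAt I x₀ (f z')))
    (funext fun i => (fderiv_extChartAt_comp hd hz2 (w i)).symm)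

theorem SmoothForm.contDiffAt {k : ℕ} {α : DiffForm I M k} (hα : SmoothForm α) {x₀ : M} {y : E}
    (hy : y ∈ (extChartAt I x₀).target) : ContDiffAt ℝ ∞ (inChart α x₀) y :=
  (hα x₀).contDiffAt ((isOpen_extChartAt_target x₀).mem_nhds hy)

/-- The exterior derivative commutes with the pullback to a normed space. -/
theorem extDeriv_pullback_eq_pullback_extD {k : ℕ} {α : DiffForm I M k} (hα : SmoothForm α)
    {f : F → M} {z : F} (hf : ContMDiffAt 𝓘(ℝ, F) I ∞ f z) :
    extDeriv (flatPullback f α) z =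
      flatPullback f (extD α) z := by
  have hx : f z ∈ (extChartAt I (f z)).source := mem_extChartAt_source _
  rw [(pullback_eventuallyEq_inChart α hf hx).extDeriv_eq]
  have h1 := (hα.contDiffAt ((extChartAt I (f z)).map_source hx)).differentiableAt (by simp)
  have h2 := contDiffAt_extChartAt_comp hf hx
  -- Naturality of `d` between normed spaces. It needs two derivatives of the map, since the second
  -- derivative must drop out by symmetry.
  have h3 := extDeriv_pullback (r := ∞) (f := fun z' => extChartAt I (f z) (f z'))
    (x := z) h1 h2
    (by rw [minSmoothness_of_isRCLikeNormedField]; exact WithTop.coe_le_coe.2 (le_top : (2 : ℕ∞) ≤ ⊤))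
  rw [h3]
  ext w
  exact congrArg (extDeriv (inChart α (f z)) (extChartAt I (f z) (f z)))
    (funext fun i => fderiv_extChartAt_comp (hf.mdifferentiableAt (by simp)) hx (w i))

theorem differentiableAt_pullback {k : ℕ} {α : DiffForm I M k} (hα : SmoothForm α)
    {f : F → M} {z : F} (hf : ContMDiffAt 𝓘(ℝ, F) I ∞ f z) :
    DifferentiableAt ℝ (flatPullback f α) z := by
  have hx : f z ∈ (extChartAt I (f z)).source := mem_extChartAt_source _
  refine DifferentiableAt.congr_of_eventuallyEq ?_ (pullback_eventuallyEq_inChart α hf hx)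
  have h2 := contDiffAt_extChartAt_comp hf hx
  refine DifferentiableAt.continuousAlternatingMapCompContinuousLinearMap
    (f := fun z' => inChart α (f z) (extChartAt I (f z) (f z')))
    (g := fun z' => fderiv ℝ (fun z' => extChartAt I (f z) (f z')) z') ?_ ?_
  · exact ((hα.contDiffAt ((extChartAt I (f z)).map_source hx)).differentiableAt (by simp)).comp z
      (h2.differentiableAt (by simp))
  · exact (h2.fderiv_right (m := 1) (by norm_cast)).differentiableAt (by simp)

theorem contMDiffAt_extChartAt_symm' {x₀ : M} {y : E} (hy : y ∈ (extChartAt I x₀).target) :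
    ContMDiffAt 𝓘(ℝ, E) I ∞ (extChartAt I x₀).symm y :=
  (contMDiffOn_extChartAt_symm x₀).contMDiffAt ((isOpen_extChartAt_target x₀).mem_nhds hy)

/-- The exterior derivative can be computed in any chart. -/
theorem inChart_extD {k : ℕ} {α : DiffForm I M k} (hα : SmoothForm α) {x₀ : M} {y : E}
    (hy : y ∈ (extChartAt I x₀).target) :
    inChart (extD α) x₀ y = extDeriv (inChart α x₀) y :=
  (extDeriv_pullback_eq_pullback_extD hα (contMDiffAt_extChartAt_symm' hy)).symm

/-- In a chart, `d` is a continuous linear image of the Fréchet derivative of the coefficients.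
Continuity is all that Stokes' theorem and the compactness arguments require of `ω_σ`. -/
theorem SmoothForm.continuousOn_inChart_extD {k : ℕ} {α : DiffForm I M k} (hα : SmoothForm α)
    (x₀ : M) : ContinuousOn (inChart (extD α) x₀) (extChartAt I x₀).target := by
  refine ContinuousOn.congr ?_ fun y hy => inChart_extD hα hy
  intro y hy
  refine ContinuousAt.continuousWithinAt ?_
  have h := ((hα.contDiffAt hy).fderiv_right (m := 0) (by simp)).continuousAt
  exact (ContinuousAlternatingMap.alternatizeUncurryFinCLM ℝ E ℝ).continuous.continuousAt.comp h

theorem extDeriv_one_apply {A : F → F [⋀^Fin 1]→L[ℝ] ℝ} {z : F} (hA : DifferentiableAt ℝ A z)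
    (u w : F) :
    extDeriv A z ![u, w] =
      fderiv ℝ (fun z => A z ![w]) z u - fderiv ℝ (fun z => A z ![u]) z w := by
  rw [extDeriv_apply hA, Fin.sum_univ_two]
  have h0 : (0 : Fin 2).removeNth ![u, w] = ![w] := by ext i; fin_cases i; rfl
  have h1 : (1 : Fin 2).removeNth ![u, w] = ![u] := by ext i; fin_cases i; rfl
  rw [h0, h1]
  simp [sub_eq_add_neg]

end FormCalculus

/-! ### Bundle charts of the cotangent bundle and the canonical form -/

section CotangentCharts

variable {n : ℕ} {N : Type*} [TopologicalSpace N] [ChartedSpace (EuclideanSpace ℝ (Fin n)) N]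
  [IsManifold (𝓡 n) ∞ N]

theorem extChartAt_cotangent_fst (x₀ x : Cotangent n N) :
    (extChartAt (coI n) x₀ x).1 = extChartAt (𝓡 n) x₀.proj x.proj := by
  simp only [extChartAt, OpenPartialHomeomorph.extend, PartialEquiv.coe_trans,
    ModelWithCorners.toPartialEquiv_coe, OpenPartialHomeomorph.toFun_eq_coe, Function.comp_apply]
  rw [hom_chart]
  rfl

theorem mem_extChartAt_source_cotangent {x₀ x : Cotangent n N} :
    x ∈ (extChartAt (coI n) x₀).source ↔ x.proj ∈ (extChartAt (𝓡 n) x₀.proj).source := by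
  simp only [extChartAt_source]
  rw [FiberBundle.chartedSpace_chartAt]
  simp only [hom_trivializationAt_source, mfld_simps]
  exact ⟨fun h => h.1.1, fun h => ⟨⟨h, mem_univ _⟩, h⟩⟩

/-- The hom-bundle chart conjugates a covector by the tangent trivialization, which is the
derivative of the base chart. This is what makes the fibre coordinates the canonical momenta. -/
theorem momentum_apply_eq_chart {x₀ x : Cotangent n N}
    (hx : x.proj ∈ (extChartAt (𝓡 n) x₀.proj).source) (w : TangentSpace (𝓡 n) x.proj) :
    momentum x w = (extChartAt (coI n) x₀ x).2
      (chartDeriv (𝓡 n) x₀.proj x.proj w) := by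
  have hx' : x.proj ∈ (chartAt (EuclideanSpace ℝ (Fin n)) x₀.proj).source := by
    rwa [extChartAt_source] at hx
  have h : (extChartAt (coI n) x₀ x).2 = ContinuousLinearMap.inCoordinates
      (EuclideanSpace ℝ (Fin n)) (fun q : N => TangentSpace (𝓡 n) q) ℝ (Bundle.Trivial N ℝ)
      x₀.proj x.proj x₀.proj x.proj x.snd := by
    simp only [extChartAt, OpenPartialHomeomorph.extend, PartialEquiv.coe_trans,
      ModelWithCorners.toPartialEquiv_coe, OpenPartialHomeomorph.toFun_eq_coe, Function.comp_apply]
    rw [hom_chart]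
    rfl
  have h2 : (trivializationAt (EuclideanSpace ℝ (Fin n)) (fun q : N => TangentSpace (𝓡 n) q)
      x₀.proj).symmL ℝ x.proj ((trivializationAt (EuclideanSpace ℝ (Fin n))
      (fun q : N => TangentSpace (𝓡 n) q) x₀.proj).continuousLinearMapAt ℝ x.proj w) = w :=
    Trivialization.symmL_continuousLinearMapAt _ (by simpa using hx') w
  rw [TangentBundle.continuousLinearMapAt_trivializationAt hx'] at h2
  rw [h]
  have h3 : ∀ v : ℝ, (trivializationAt ℝ (Bundle.Trivial N ℝ) x₀.proj).continuousLinearMapAt ℝ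
      x.proj v = v := fun v => by
    rw [Trivialization.continuousLinearMapAt_apply,
      Trivialization.coe_linearMapAt_of_mem _ (mem_univ _)]
    rfl
  refine Eq.trans ?_ (h3 _).symm
  exact (congrArg (x.snd : TangentSpace (𝓡 n) x.proj → ℝ) h2).symm

theorem contMDiff_footpoint : ContMDiff (coI n) (𝓡 n) ∞ (footpoint n N) :=
  contMDiff_proj _

theorem extChartAt_comp_mfderiv_footpoint {x₀ x : Cotangent n N}
    (hx : x ∈ (extChartAt (coI n) x₀).source) (w : TangentSpace (coI n) x) :
    chartDeriv (𝓡 n) x₀.proj x.proj (mfderiv (coI n) (𝓡 n) (footpoint n N) x w) =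
    (chartDeriv (coI n) x₀ x w).1 := by
  have hq := mem_extChartAt_source_cotangent.1 hx
  have h1 := mfderiv_comp x (mdifferentiableAt_extChartAt_of_mem (I := 𝓡 n) hq)
    ((contMDiff_footpoint (N := N)).mdifferentiableAt (x := x) (by simp))
  have h2 := mfderiv_comp x (I'' := 𝓘(ℝ, EuclideanSpace ℝ (Fin n)))
    (g := (Prod.fst : EuclideanSpace ℝ (Fin n) × CoModel n → _))
    (differentiableAt_fst.mdifferentiableAt)
    (mdifferentiableAt_extChartAt_of_mem (I := coI n) hx)
  have h3 : (extChartAt (𝓡 n) x₀.proj) ∘ footpoint n N = Prod.fst ∘ (extChartAt (coI n) x₀) := by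
    ext1 y
    exact (extChartAt_cotangent_fst x₀ y).symm
  change mfderiv _ _ (_ ∘ footpoint n N) x = _ at h1
  rw [h3, h2, mfderiv_eq_fderiv, fderiv_fst] at h1
  exact (DFunLike.congr_fun h1 w).symm

/-- The Liouville form in a bundle chart is `p dq`. -/
theorem inChart_liouville {x₀ : Cotangent n N} {y : EuclideanSpace ℝ (Fin n) × CoModel n}
    (hy : y ∈ (extChartAt (coI n) x₀).target) (w : EuclideanSpace ℝ (Fin n) × CoModel n) :
    inChart (liouville n N) x₀ y ![w] = y.2 w.1 := by
  have hx := (extChartAt (coI n) x₀).map_target hy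
  have hq := mem_extChartAt_source_cotangent.1 hx
  set x := (extChartAt (coI n) x₀).symm y with hxdef
  have h1 := momentum_apply_eq_chart hq (mfderiv (coI n) (𝓡 n) (footpoint n N) x
    (mfderiv 𝓘(ℝ, EuclideanSpace ℝ (Fin n) × CoModel n) (coI n) (extChartAt (coI n) x₀).symm y w))
  refine h1.trans ?_
  have h2 := extChartAt_comp_mfderiv_footpoint hx (mfderiv 𝓘(ℝ, EuclideanSpace ℝ (Fin n) × CoModel n)
    (coI n) (extChartAt (coI n) x₀).symm y w)
  have h3 := mfderiv_extChartAt_apply_symm hy w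
  have h4 : extChartAt (coI n) x₀ x = y := (extChartAt (coI n) x₀).right_inv hy
  refine (congrArg (extChartAt (coI n) x₀ x).2 h2).trans ?_
  refine (congrArg (fun v : EuclideanSpace ℝ (Fin n) × CoModel n =>
    (extChartAt (coI n) x₀ x).2 v.1) h3).trans ?_
  rw [h4]

/-- The form `p dq` on `ℝⁿ × (ℝⁿ)*`. -/
def flatLiouville (n : ℕ) : (EuclideanSpace ℝ (Fin n) × CoModel n) →L[ℝ]
    (EuclideanSpace ℝ (Fin n) × CoModel n) [⋀^Fin 1]→L[ℝ] ℝ :=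
  (ContinuousAlternatingMap.ofSubsingletonLIE (𝕜 := ℝ) (F := ℝ)
    (E := EuclideanSpace ℝ (Fin n) × CoModel n) (0 : Fin 1)).toContinuousLinearEquiv ∘L
    (ContinuousLinearMap.compL ℝ (EuclideanSpace ℝ (Fin n) × CoModel n)
      (EuclideanSpace ℝ (Fin n)) ℝ).flip (ContinuousLinearMap.fst ℝ _ _) ∘L
      ContinuousLinearMap.snd ℝ _ _

theorem flatLiouville_apply (y w : EuclideanSpace ℝ (Fin n) × CoModel n) :
    flatLiouville n y ![w] = y.2 w.1 := rfl

theorem inChart_liouville_eq {x₀ : Cotangent n N} {y : EuclideanSpace ℝ (Fin n) × CoModel n}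
    (hy : y ∈ (extChartAt (coI n) x₀).target) :
    inChart (liouville n N) x₀ y = flatLiouville n y := by
  ext w
  have hw : w = ![w 0] := by ext1 i; fin_cases i; rfl
  rw [hw, inChart_liouville hy, flatLiouville_apply]

theorem smoothForm_liouville : SmoothForm (liouville n N) := fun _ =>
  (flatLiouville n).contDiff.contDiffOn.congr fun _ hy => inChart_liouville_eq hy

/-- The coefficients of `p dq` are linear in the bundle coordinates, so they are their own
derivative and the form is constant there. -/
theorem inChart_extD_liouville {x₀ : Cotangent n N} {y : EuclideanSpace ℝ (Fin n) × CoModel n}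
    (hy : y ∈ (extChartAt (coI n) x₀).target) (u w : EuclideanSpace ℝ (Fin n) × CoModel n) :
    inChart (extD (liouville n N)) x₀ y ![u, w] = u.2 w.1 - w.2 u.1 := by
  rw [inChart_extD smoothForm_liouville hy]
  have h : inChart (liouville n N) x₀ =ᶠ[𝓝 y] flatLiouville n := by
    filter_upwards [(isOpen_extChartAt_target x₀).mem_nhds hy] with z hz
    exact inChart_liouville_eq hz
  rw [h.extDeriv_eq, extDeriv_one_apply (flatLiouville n).differentiableAt]
  have hd : ∀ v : EuclideanSpace ℝ (Fin n) × CoModel n,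
      HasFDerivAt (fun z => flatLiouville n z ![v])
        ((ContinuousLinearMap.apply ℝ ℝ v.1) ∘L ContinuousLinearMap.snd ℝ _ _) y := fun v =>
    ((ContinuousLinearMap.apply ℝ ℝ v.1) ∘L ContinuousLinearMap.snd ℝ
      (EuclideanSpace ℝ (Fin n)) (CoModel n)).hasFDerivAt
  rw [(hd u).fderiv, (hd w).fderiv]
  rfl

/-- The canonical form `dp ∧ dq` in a bundle chart. -/
theorem extD_liouville_apply {x₀ x : Cotangent n N} (hx : x ∈ (extChartAt (coI n) x₀).source)
    (u w : TangentSpace (coI n) x) :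
    extD (liouville n N) x ![u, w] =
      (chartDeriv (coI n) x₀ x u).2
      (chartDeriv (coI n) x₀ x w).1 -
      (chartDeriv (coI n) x₀ x w).2
      (chartDeriv (coI n) x₀ x u).1 := by
  rw [two_form_apply_eq_inChart _ hx,
    inChart_extD_liouville ((extChartAt (coI n) x₀).map_source hx)]

end CotangentCharts

/-! ### Linear algebra of bilinear forms -/

section BilinearForms

variable {V : Type*} [AddCommGroup V] [Module ℝ V]

theorem exists_eq_of_nondegenerate [FiniteDimensional ℝ V] (b : V →ₗ[ℝ] Module.Dual ℝ V)
    (hb : ∀ u, (∀ w, b u w = 0) → u = 0) (p : Module.Dual ℝ V) : ∃ u, b u = p := by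
  have hinj : Function.Injective b := by
    rw [← LinearMap.ker_eq_bot, LinearMap.ker_eq_bot']
    exact fun u hu => hb u fun w => by rw [hu]; rfl
  exact (LinearMap.injective_iff_surjective_of_finrank_eq_finrank
    (Subspace.dual_finrank_eq).symm).1 hinj p

variable [TopologicalSpace V]

/-- Cauchy–Schwarz by the discriminant of `t ↦ b (u + t w) (u + t w)`; semidefiniteness suffices. -/
theorem apply_sq_le_of_pos (b : V →L[ℝ] V →L[ℝ] ℝ) (hs : ∀ u w, b u w = b w u)
    (hp : ∀ u, 0 ≤ b u u) (u w : V) : b u w ^ 2 ≤ b u u * b w w := by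
  have h : ∀ t : ℝ, 0 ≤ b w w * (t * t) + (2 * b u w) * t + b u u := fun t => by
    have := hp (u + t • w)
    simp only [map_add, map_smul, add_apply, smul_apply, smul_eq_mul, hs w u] at this
    linarith
  have := discrim_le_zero h
  rw [discrim] at this
  nlinarith

end BilinearForms

/-! ### The dual norm of a Riemannian metric and its smoothness -/

section DualNorm

variable {n : ℕ} {N : Type*} [TopologicalSpace N] [ChartedSpace (EuclideanSpace ℝ (Fin n)) N]
  [IsManifold (𝓡 n) ∞ N]
  (g : ContMDiffRiemannianMetric (𝓡 n) ∞ (EuclideanSpace ℝ (Fin n))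
    (fun q : N => TangentSpace (𝓡 n) q))

theorem metric_self_nonneg (q : N) (u : TangentSpace (𝓡 n) q) : 0 ≤ g.inner q u u := by
  by_cases h : u = 0
  · simp [h]
  · exact (g.pos q u h).le

theorem exists_sharp (q : N) (p : TangentSpace (𝓡 n) q →L[ℝ] ℝ) :
    ∃ u : TangentSpace (𝓡 n) q, ∀ w, g.inner q u w = p w := by
  have : FiniteDimensional ℝ (TangentSpace (𝓡 n) q) :=
    inferInstanceAs (FiniteDimensional ℝ (EuclideanSpace ℝ (Fin n)))
  let b : TangentSpace (𝓡 n) q →ₗ[ℝ] Module.Dual ℝ (TangentSpace (𝓡 n) q) :=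
    { toFun := fun u => (g.inner q u).toLinearMap
      map_add' := fun u w => by ext; simp
      map_smul' := fun c u => by ext; simp }
  obtain ⟨u, hu⟩ := exists_eq_of_nondegenerate b (fun u hu => by
    by_contra h
    exact (g.pos q u h).ne' (hu u)) p.toLinearMap
  exact ⟨u, fun w => DFunLike.congr_fun hu w⟩

/-- The tangent vector that represents a covector with respect to the metric. -/
def sharp (q : N) (p : TangentSpace (𝓡 n) q →L[ℝ] ℝ) : TangentSpace (𝓡 n) q :=
  (exists_sharp g q p).choose

theorem inner_sharp (q : N) (p : TangentSpace (𝓡 n) q →L[ℝ] ℝ) (w : TangentSpace (𝓡 n) q) :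
    g.inner q (sharp g q p) w = p w :=
  (exists_sharp g q p).choose_spec w

theorem eq_sharp {q : N} {p : TangentSpace (𝓡 n) q →L[ℝ] ℝ} {u : TangentSpace (𝓡 n) q}
    (hu : ∀ w, g.inner q u w = p w) : u = sharp g q p := by
  by_contra h
  refine (g.pos q (u - sharp g q p) (sub_ne_zero.2 h)).ne' ?_
  have h2 : ∀ z, g.inner q (u - sharp g q p) z = 0 := fun z => by
    simp only [map_sub, sub_apply, hu, inner_sharp, sub_self]
  exact h2 _

theorem inner_sharp_self (q : N) (p : TangentSpace (𝓡 n) q →L[ℝ] ℝ) :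
    p (sharp g q p) = g.inner q (sharp g q p) (sharp g q p) :=
  (inner_sharp g q p _).symm

theorem covector_apply_sq_le (q : N) (p : TangentSpace (𝓡 n) q →L[ℝ] ℝ)
    (w : TangentSpace (𝓡 n) q) : p w ^ 2 ≤ p (sharp g q p) * g.inner q w w := by
  rw [inner_sharp_self, ← inner_sharp g q p w]
  exact apply_sq_le_of_pos (g.inner q) (g.symm q) (metric_self_nonneg g q) _ _

/-- The supremum is attained at the normalized dual vector. When the dual vector has length zero,
any vector of the unit ball does, and `0` is taken. -/
theorem dualNorm_eq_sqrt (q : N) (p : TangentSpace (𝓡 n) q →L[ℝ] ℝ) :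
    dualNorm g q p = √(p (sharp g q p)) := by
  have h0 : 0 ≤ p (sharp g q p) := by
    rw [inner_sharp_self]; exact metric_self_nonneg g q _
  refine IsGreatest.csSup_eq ⟨?_, ?_⟩
  · rcases h0.eq_or_lt with h | h
    · exact ⟨0, by simp, by rw [← h]; simp⟩
    · have hs := Real.sqrt_pos.2 h
      refine ⟨(√(p (sharp g q p)))⁻¹ • sharp g q p, ?_, ?_⟩
      · simp only [map_smul, smul_apply, smul_eq_mul]
        rw [← inner_sharp_self, ← mul_assoc, ← mul_inv, Real.mul_self_sqrt h0,
          inv_mul_cancel₀ h.ne']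
      · rw [map_smul, smul_eq_mul, inv_mul_eq_div, Real.div_sqrt]
  · rintro r ⟨u, hu, rfl⟩
    refine Real.le_sqrt_of_sq_le ((covector_apply_sq_le g q p u).trans ?_)
    exact mul_le_of_le_one_right h0 hu

theorem dualNorm_sq (q : N) (p : TangentSpace (𝓡 n) q →L[ℝ] ℝ) :
    dualNorm g q p ^ 2 = p (sharp g q p) := by
  rw [dualNorm_eq_sqrt, Real.sq_sqrt]
  rw [inner_sharp_self]
  exact metric_self_nonneg g q _

theorem dualNorm_nonneg (q : N) (p : TangentSpace (𝓡 n) q →L[ℝ] ℝ) : 0 ≤ dualNorm g q p := by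
  rw [dualNorm_eq_sqrt]
  exact Real.sqrt_nonneg _

theorem abs_covector_apply_le (q : N) (p : TangentSpace (𝓡 n) q →L[ℝ] ℝ)
    (w : TangentSpace (𝓡 n) q) : |p w| ≤ dualNorm g q p * √(g.inner q w w) := by
  refine abs_le_of_sq_le_sq ?_ (mul_nonneg (dualNorm_nonneg g q p) (Real.sqrt_nonneg _))
  rw [mul_pow, dualNorm_sq, Real.sq_sqrt (metric_self_nonneg g q w)]
  exact covector_apply_sq_le g q p w

theorem sharp_add_smul (q : N) (p a : TangentSpace (𝓡 n) q →L[ℝ] ℝ) (s : ℝ) :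
    sharp g q (p + s • a) = sharp g q p + s • sharp g q a := by
  refine (eq_sharp g fun w => ?_).symm
  simp [inner_sharp]

theorem covector_apply_sharp_comm (q : N) (p a : TangentSpace (𝓡 n) q →L[ℝ] ℝ) :
    p (sharp g q a) = a (sharp g q p) := by
  rw [← inner_sharp g q p, ← inner_sharp g q a, g.symm]

theorem dualNorm_add_smul_sq (q : N) (p a : TangentSpace (𝓡 n) q →L[ℝ] ℝ) (s : ℝ) :
    dualNorm g q (p + s • a) ^ 2 =
      dualNorm g q p ^ 2 + 2 * s * a (sharp g q p) + s ^ 2 * dualNorm g q a ^ 2 := by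
  simp only [dualNorm_sq, sharp_add_smul, map_add, map_smul, add_apply,
    smul_apply, smul_eq_mul, covector_apply_sharp_comm g q p a]
  ring

/-- The difference of the two sides is `|p + a|² / 2`. This is where the energy gap between `p` and
`a` becomes a lower bound for the primitive on the Hamiltonian vector field. -/
theorem dualNorm_sq_sub_le (q : N) (p a : TangentSpace (𝓡 n) q →L[ℝ] ℝ) :
    (dualNorm g q p ^ 2 - dualNorm g q a ^ 2) / 2 ≤ (p + a) (sharp g q p) := by
  have h := dualNorm_add_smul_sq g q p a 1
  rw [add_apply, ← dualNorm_sq]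
  nlinarith [sq_nonneg (dualNorm g q (p + (1 : ℝ) • a))]

/-- The metric read in the chart around `q₀`. -/
def metricInChart (q₀ q : N) :
    EuclideanSpace ℝ (Fin n) →L[ℝ] EuclideanSpace ℝ (Fin n) →L[ℝ] ℝ :=
  ContinuousLinearMap.inCoordinates (EuclideanSpace ℝ (Fin n)) (fun q : N => TangentSpace (𝓡 n) q)
    (EuclideanSpace ℝ (Fin n) →L[ℝ] ℝ)
    (fun q : N => TangentSpace (𝓡 n) q →L[ℝ] Bundle.Trivial N ℝ q) q₀ q q₀ q (g.inner q)

theorem metricInChart_apply {q₀ q : N} (hq : q ∈ (extChartAt (𝓡 n) q₀).source)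
    (u w : EuclideanSpace ℝ (Fin n)) :
    metricInChart g q₀ q u w =
      g.inner q (chartDerivSymm (𝓡 n) q₀ q u) (chartDerivSymm (𝓡 n) q₀ q w) := by
  have hq' : q ∈ (chartAt (EuclideanSpace ℝ (Fin n)) q₀).source := by
    rwa [extChartAt_source] at hq
  have hb : q ∈ (trivializationAt (EuclideanSpace ℝ (Fin n))
    (fun q : N => TangentSpace (𝓡 n) q) q₀).baseSet := by simpa using hq'
  have hs : ∀ v, (trivializationAt (EuclideanSpace ℝ (Fin n))
      (fun q : N => TangentSpace (𝓡 n) q) q₀).symm q v = chartDerivSymm (𝓡 n) q₀ q v := fun v => by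
    have h := TangentBundle.symmL_trivializationAt (I := 𝓡 n) hq'
    rw [ModelWithCorners.range_eq_univ, mfderivWithin_univ] at h
    have h2 := DFunLike.congr_fun h v
    rwa [Trivialization.symmL_apply _ hb] at h2
  unfold metricInChart
  rw [inCoordinates_apply_eq₂ hb hb (mem_univ _),
    Trivialization.coe_linearMapAt_of_mem _ (mem_univ _), hs, hs]
  rfl

theorem metricInChart_chartDeriv {q₀ q : N} (hq : q ∈ (extChartAt (𝓡 n) q₀).source)
    (u w : TangentSpace (𝓡 n) q) :
    metricInChart g q₀ q (chartDeriv (𝓡 n) q₀ q u) (chartDeriv (𝓡 n) q₀ q w) =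
      g.inner q u w := by
  rw [metricInChart_apply g hq, chartDerivSymm_chartDeriv hq, chartDerivSymm_chartDeriv hq]

theorem contMDiffAt_metricInChart (q₀ : N) :
    ContMDiffAt (𝓡 n) 𝓘(ℝ, EuclideanSpace ℝ (Fin n) →L[ℝ] EuclideanSpace ℝ (Fin n) →L[ℝ] ℝ) ∞
      (metricInChart g q₀) q₀ :=
  ((contMDiffAt_hom_bundle _).1 (g.contMDiff q₀)).2

theorem isInvertible_metricInChart {q₀ q : N} (hq : q ∈ (extChartAt (𝓡 n) q₀).source) :
    (metricInChart g q₀ q).IsInvertible := by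
  have hinj : Function.Injective (metricInChart g q₀ q).toLinearMap := by
    rw [← LinearMap.ker_eq_bot, LinearMap.ker_eq_bot']
    intro u hu
    have h1 : metricInChart g q₀ q u u = 0 := DFunLike.congr_fun hu u
    rw [metricInChart_apply g hq] at h1
    by_contra hne
    refine (g.pos q (chartDerivSymm (𝓡 n) q₀ q u) fun h0 => hne ?_).ne' h1
    rw [← chartDeriv_chartDerivSymm hq u, h0, map_zero]
  have hdim : Module.finrank ℝ (EuclideanSpace ℝ (Fin n)) =
      Module.finrank ℝ (EuclideanSpace ℝ (Fin n) →L[ℝ] ℝ) := by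
    rw [← (LinearMap.toContinuousLinearMap (𝕜 := ℝ) (E := EuclideanSpace ℝ (Fin n))
      (F' := ℝ)).finrank_eq]
    exact (Subspace.dual_finrank_eq (K := ℝ) (V := EuclideanSpace ℝ (Fin n))).symm
  refine ⟨(LinearEquiv.ofInjectiveOfFinrankEq _ hinj hdim).toContinuousLinearEquiv, ?_⟩
  ext1 u
  rfl

theorem dualNorm_sq_eq_chart {x₀ x : Cotangent n N} (hx : x ∈ (extChartAt (coI n) x₀).source) :
    dualNorm g x.proj (momentum x) ^ 2 =
      (extChartAt (coI n) x₀ x).2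
        ((metricInChart g x₀.proj x.proj).inverse (extChartAt (coI n) x₀ x).2) := by
  have hq := mem_extChartAt_source_cotangent.1 hx
  set p := (extChartAt (coI n) x₀ x).2 with hp
  set u := (metricInChart g x₀.proj x.proj).inverse p with hu
  have h1 : chartDerivSymm (𝓡 n) x₀.proj x.proj u = sharp g x.proj (momentum x) := by
    refine eq_sharp g fun w => ?_
    rw [momentum_apply_eq_chart hq, ← metricInChart_chartDeriv g hq, chartDeriv_chartDerivSymm hq,
      hu, (isInvertible_metricInChart g hq).self_apply_inverse]
  rw [dualNorm_sq, ← h1, momentum_apply_eq_chart hq, chartDeriv_chartDerivSymm hq]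

/-- A supremum carries no visible smoothness. In a chart, however, the squared norm is `p (G⁻¹ p)`
with `G` the metric matrix, and inversion is smooth at invertible maps. -/
theorem contMDiff_dualNorm_sq : ContMDiff (coI n) 𝓘(ℝ, ℝ) ∞
    (fun x : Cotangent n N => dualNorm g x.proj (momentum x) ^ 2) := by
  intro x₀
  have h1 : (fun x : Cotangent n N => dualNorm g x.proj (momentum x) ^ 2) =ᶠ[𝓝 x₀]
      fun x => (extChartAt (coI n) x₀ x).2
        ((metricInChart g x₀.proj x.proj).inverse (extChartAt (coI n) x₀ x).2) := by
    filter_upwards [extChartAt_source_mem_nhds (I := coI n) x₀] with x hx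
    exact dualNorm_sq_eq_chart g hx
  refine ContMDiffAt.congr_of_eventuallyEq ?_ h1
  have h2 : ContMDiffAt (coI n) 𝓘(ℝ, CoModel n) ∞ (fun x => (extChartAt (coI n) x₀ x).2) x₀ := by
    have := contMDiffAt_extChartAt (I := coI n) (n := ∞) (x := x₀)
    exact (contDiff_snd.contMDiff.contMDiffAt (n := ∞)).comp x₀ this
  have h3 : ContMDiffAt (coI n) 𝓘(ℝ, CoModel n →L[ℝ] EuclideanSpace ℝ (Fin n)) ∞
      (fun x : Cotangent n N => (metricInChart g x₀.proj x.proj).inverse) x₀ := by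
    obtain ⟨e, he⟩ := isInvertible_metricInChart g (mem_extChartAt_source (I := 𝓡 n) x₀.proj)
    have h4 := contDiffAt_map_inverse (n := ∞) e
    rw [he] at h4
    exact h4.contMDiffAt.comp x₀
      ((contMDiffAt_metricInChart g x₀.proj).comp x₀ (contMDiff_proj _ x₀))
  exact ContMDiffAt.clm_apply h2 (h3.clm_apply h2)

end DualNorm

/-! ### Continuous forms and vector fields along maps -/

section ContinuousForms

variable {E : Type*} [NormedAddCommGroup E] [NormedSpace ℝ E]
  {H : Type*} [TopologicalSpace H] {I : ModelWithCorners ℝ E H} [I.Boundaryless]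
  {M : Type*} [TopologicalSpace M] [ChartedSpace H M] [IsManifold I ∞ M]
  {E' : Type*} [NormedAddCommGroup E'] [NormedSpace ℝ E']
  {H' : Type*} [TopologicalSpace H'] {I' : ModelWithCorners ℝ E' H'} [I'.Boundaryless]
  {M' : Type*} [TopologicalSpace M'] [ChartedSpace H' M'] [IsManifold I' ∞ M']
  {F : Type*} [NormedAddCommGroup F] [NormedSpace ℝ F]

/-- Continuity of a differential form: its coefficients are continuous in every chart. -/
def ContinuousForm {k : ℕ} (α : DiffForm I M k) : Prop :=
  ∀ x₀ : M, ContinuousOn (inChart α x₀) (extChartAt I x₀).target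

theorem ContinuousForm.continuousAt {k : ℕ} {α : DiffForm I M k} (hα : ContinuousForm α) {x₀ x : M}
    (hx : x ∈ (extChartAt I x₀).source) : ContinuousAt (inChart α x₀) (extChartAt I x₀ x) :=
  (hα x₀).continuousAt ((isOpen_extChartAt_target x₀).mem_nhds ((extChartAt I x₀).map_source hx))

theorem flatPullback_comp {k : ℕ} (α : DiffForm I M k) {f : M' → M} {h : F → M'} {z : F}
    (hf : MDifferentiableAt I' I f (h z)) (hh : MDifferentiableAt 𝓘(ℝ, F) I' h z) :
    flatPullback h (pullback (I := I') f α) z = flatPullback (f ∘ h) α z := by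
  ext w
  have h1 := mfderiv_comp z hf hh
  exact congrArg (α (f (h z))) (funext fun i => (DFunLike.congr_fun h1 (w i)).symm)

theorem continuousForm_pullback {k : ℕ} {α : DiffForm I M k} (hα : SmoothForm α) {f : M' → M}
    (hf : ContMDiff I' I ∞ f) : ContinuousForm (pullback (I := I') f α) := by
  intro x₀
  have h : EqOn (inChart (pullback (I := I') f α) x₀)
      (flatPullback (f ∘ (extChartAt I' x₀).symm) α) (extChartAt I' x₀).target := fun y hy =>
    flatPullback_comp α (hf.mdifferentiableAt (by simp))
      ((contMDiffAt_extChartAt_symm' hy).mdifferentiableAt (by simp))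
  refine ContinuousOn.congr (fun y hy => ?_) h
  exact (differentiableAt_pullback hα
    (hf.contMDiffAt.comp y (contMDiffAt_extChartAt_symm' hy))).continuousAt.continuousWithinAt

theorem ContinuousForm.add {k : ℕ} {α β : DiffForm I M k} (hα : ContinuousForm α)
    (hβ : ContinuousForm β) : ContinuousForm (α + β) := fun x₀ =>
  (hα x₀).add (hβ x₀)

/-- A continuous form evaluated on continuous vector fields along a continuous map. -/
theorem ContinuousForm.continuousAt_apply {α : DiffForm I M 2} (hα : ContinuousForm α)
    {X : Type*} [TopologicalSpace X] {c : X → M} {t : X} (hc : ContinuousAt c t)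
    {u w : ∀ t, TangentSpace I (c t)}
    (hu : ContinuousAt (fun s => chartDeriv I (c t) (c s) (u s)) t)
    (hw : ContinuousAt (fun s => chartDeriv I (c t) (c s) (w s)) t) :
    ContinuousAt (fun s => α (c s) ![u s, w s]) t := by
  have h1 : (fun s => α (c s) ![u s, w s]) =ᶠ[𝓝 t] fun s =>
      inChart α (c t) (extChartAt I (c t) (c s))
        ![chartDeriv I (c t) (c s) (u s), chartDeriv I (c t) (c s) (w s)] := by
    filter_upwards [hc.preimage_mem_nhds (extChartAt_source_mem_nhds (I := I) (c t))] with s hs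
    exact two_form_apply_eq_inChart α hs _ _
  refine ContinuousAt.congr ?_ h1.symm
  have h2 : ContinuousAt (fun s => inChart α (c t) (extChartAt I (c t) (c s))) t :=
    ContinuousAt.comp (f := fun s => extChartAt I (c t) (c s))
      (hα.continuousAt (mem_extChartAt_source (c t)))
      ((continuousAt_extChartAt (c t)).comp hc)
  refine h2.eval ?_
  rw [continuousAt_pi]
  intro i
  fin_cases i
  · exact hu
  · exact hw

/-- Vector fields of the form `∂f/∂u` are continuous. -/
theorem continuousAt_chartDeriv_mfderiv {f : F → M} {z : F} (hf : ContMDiff 𝓘(ℝ, F) I ∞ f) (u : F) :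
    ContinuousAt (fun s => chartDeriv I (f z) (f s) (mfderiv 𝓘(ℝ, F) I f s u)) z := by
  have hx := mem_extChartAt_source (I := I) (f z)
  have h1 : (fun s => chartDeriv I (f z) (f s) (mfderiv 𝓘(ℝ, F) I f s u)) =ᶠ[𝓝 z]
      fun s => fderiv ℝ (fun s => extChartAt I (f z) (f s)) s u := by
    filter_upwards [hf.continuous.continuousAt.preimage_mem_nhds
      (extChartAt_source_mem_nhds (I := I) (f z))] with s hs
    exact (fderiv_extChartAt_comp (hf.mdifferentiableAt (by simp)) hs u).symm
  refine ContinuousAt.congr ?_ h1.symm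
  exact ((contDiffAt_extChartAt_comp hf.contMDiffAt hx).fderiv_right
    (m := 0) (by simp)).continuousAt.clm_apply continuousAt_const

end ContinuousForms

/-! ### Stokes' theorem on a rectangle -/

section Stokes

open intervalIntegral

/-- Stokes' theorem on the rectangle `[0, m] × [0, 1]`. -/
theorem integral_extDeriv_rectangle {A : ℝ × ℝ → (ℝ × ℝ) [⋀^Fin 1]→L[ℝ] ℝ}
    (hA : Differentiable ℝ A)
    (hc : Continuous fun z => extDeriv A z ![((0, 1) : ℝ × ℝ), ((1, 0) : ℝ × ℝ)]) (m : ℝ) :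
    ∫ s in (0 : ℝ)..1, ∫ t in (0 : ℝ)..m,
      extDeriv A (t, s) ![((0, 1) : ℝ × ℝ), ((1, 0) : ℝ × ℝ)] =
    (∫ t in (0 : ℝ)..m, A (t, 1) ![((1, 0) : ℝ × ℝ)]) -
      (∫ t in (0 : ℝ)..m, A (t, 0) ![((1, 0) : ℝ × ℝ)]) -
      (∫ s in (0 : ℝ)..1, A (m, s) ![((0, 1) : ℝ × ℝ)]) +
      ∫ s in (0 : ℝ)..1, A (0, s) ![((0, 1) : ℝ × ℝ)] := by
  have hd : ∀ u : ℝ × ℝ, Differentiable ℝ fun z => A z ![u] := fun u z =>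
    (hA z).continuousAlternatingMap_apply (fun _ => differentiableAt_const _)
  -- Writing `A = A_t dt + A_s ds`, the divergence of `(-A_s, A_t)` is `dA(∂_s, ∂_t)`, in the order
  -- of arguments used in `cylinderIntegral`.
  have hext : ∀ z, fderiv ℝ (fun z => -A z ![((0, 1) : ℝ × ℝ)]) z (1, 0) +
      fderiv ℝ (fun z => A z ![((1, 0) : ℝ × ℝ)]) z (0, 1) =
      extDeriv A z ![((0, 1) : ℝ × ℝ), ((1, 0) : ℝ × ℝ)] := fun z => by
    rw [extDeriv_one_apply (hA z), fderiv_fun_neg, neg_apply]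
    ring
  have h := integral2_divergence_prod_of_hasFDerivAt_off_countable
    (fun z => -A z ![((0, 1) : ℝ × ℝ)]) (fun z => A z ![((1, 0) : ℝ × ℝ)])
    (fun z => fderiv ℝ (fun z => -A z ![((0, 1) : ℝ × ℝ)]) z)
    (fun z => fderiv ℝ (fun z => A z ![((1, 0) : ℝ × ℝ)]) z) 0 0 m 1 ∅ countable_empty
    (hd _).neg.continuous.continuousOn (hd _).continuous.continuousOn
    (fun z _ => ((hd _).neg z).hasFDerivAt) (fun z _ => (hd _ z).hasFDerivAt) (by
      simp_rw [hext]
      exact hc.continuousOn.integrableOn_compact (isCompact_uIcc.prod isCompact_uIcc))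
  simp_rw [hext] at h
  rw [intervalIntegral_intervalIntegral_swap] at h
  · rw [h]
    simp only [intervalIntegral.integral_neg]
    ring
  · exact (hc.continuousOn.integrableOn_compact (isCompact_uIcc.prod isCompact_uIcc)).mono_set
      (prod_mono uIoc_subset_uIcc uIoc_subset_uIcc)

end Stokes

/-! ### Nondegenerate 2-forms and Hamiltonian vector fields -/

section HamiltonianVectorField

/-- A 2-form on a vector space as a bilinear form. -/
def curryTwoForm (E : Type*) [NormedAddCommGroup E] [NormedSpace ℝ E] :
    (E [⋀^Fin 2]→L[ℝ] ℝ) →L[ℝ] E →L[ℝ] E →L[ℝ] ℝ :=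
  (ContinuousLinearMap.compL ℝ E (E [⋀^Fin 1]→L[ℝ] ℝ) (E →L[ℝ] ℝ)
    ((ContinuousAlternatingMap.ofSubsingletonLIE (𝕜 := ℝ) (F := ℝ) (E := E)
      (0 : Fin 1)).symm.toContinuousLinearEquiv : (E [⋀^Fin 1]→L[ℝ] ℝ) →L[ℝ] E →L[ℝ] ℝ)) ∘L
    (ContinuousAlternatingMap.curryLeftLI (𝕜 := ℝ) (E := E) (F := ℝ)
      (n := 1)).toContinuousLinearMap

theorem curryTwoForm_apply {E : Type*} [NormedAddCommGroup E] [NormedSpace ℝ E]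
    (a : E [⋀^Fin 2]→L[ℝ] ℝ) (u w : E) : curryTwoForm E a u w = a ![u, w] := by
  refine congrArg a (funext fun i => ?_)
  fin_cases i <;> rfl

theorem isInvertible_curryTwoForm {E : Type*} [NormedAddCommGroup E] [NormedSpace ℝ E]
    [FiniteDimensional ℝ E] {a : E [⋀^Fin 2]→L[ℝ] ℝ} (ha : ∀ u, (∀ w, a ![u, w] = 0) → u = 0) :
    (curryTwoForm E a).IsInvertible := by
  have hinj : Function.Injective (curryTwoForm E a).toLinearMap := by
    rw [← LinearMap.ker_eq_bot, LinearMap.ker_eq_bot']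
    intro u hu
    exact ha u fun w => (curryTwoForm_apply a u w).symm.trans (DFunLike.congr_fun hu w)
  have hdim : Module.finrank ℝ E = Module.finrank ℝ (E →L[ℝ] ℝ) := by
    rw [← (LinearMap.toContinuousLinearMap (𝕜 := ℝ) (E := E) (F' := ℝ)).finrank_eq]
    exact (Subspace.dual_finrank_eq (K := ℝ) (V := E)).symm
  refine ⟨(LinearEquiv.ofInjectiveOfFinrankEq _ hinj hdim).toContinuousLinearEquiv, ?_⟩
  ext1 u
  rfl

theorem flatForm_add_left {E : Type*} [NormedAddCommGroup E] [NormedSpace ℝ E]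
    (a : E [⋀^Fin 2]→L[ℝ] ℝ) (u u' w : E) : a ![u + u', w] = a ![u, w] + a ![u', w] := by
  simp only [← curryTwoForm_apply, map_add, add_apply]

theorem flatForm_add_right {E : Type*} [NormedAddCommGroup E] [NormedSpace ℝ E]
    (a : E [⋀^Fin 2]→L[ℝ] ℝ) (u w w' : E) : a ![u, w + w'] = a ![u, w] + a ![u, w'] := by
  simp only [← curryTwoForm_apply, map_add]

theorem flatForm_smul_left {E : Type*} [NormedAddCommGroup E] [NormedSpace ℝ E]
    (a : E [⋀^Fin 2]→L[ℝ] ℝ) (c : ℝ) (u w : E) : a ![c • u, w] = c * a ![u, w] := by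
  simp only [← curryTwoForm_apply, map_smul, smul_apply, smul_eq_mul]

theorem flatForm_smul_right {E : Type*} [NormedAddCommGroup E] [NormedSpace ℝ E]
    (a : E [⋀^Fin 2]→L[ℝ] ℝ) (c : ℝ) (u w : E) : a ![u, c • w] = c * a ![u, w] := by
  simp only [← curryTwoForm_apply, map_smul, smul_eq_mul]

variable {E : Type*} [NormedAddCommGroup E] [NormedSpace ℝ E] [FiniteDimensional ℝ E]
  {H : Type*} [TopologicalSpace H] {I : ModelWithCorners ℝ E H} [I.Boundaryless]
  {M : Type*} [TopologicalSpace M] [ChartedSpace H M] [IsManifold I ∞ M]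

variable (I) in
/-- The differential of a function. -/
def differential (F : M → ℝ) (x : M) : TangentSpace I x →L[ℝ] ℝ := mfderiv I 𝓘(ℝ, ℝ) F x

/-- Nondegeneracy of a 2-form. -/
def NondegenerateForm (Ω : DiffForm I M 2) : Prop :=
  ∀ x (u : TangentSpace I x), (∀ w, Ω x ![u, w] = 0) → u = 0

theorem IsCompatibleFamily.nondegenerateForm {Ω : DiffForm I M 2}
    {J : ℝ → ∀ x : M, TangentSpace I x →L[ℝ] TangentSpace I x} (hJ : IsCompatibleFamily Ω J) :
    NondegenerateForm Ω := fun x u hu => by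
  by_contra h
  exact (hJ.pos 0 x u h).ne' (hu _)

/-- Nondegeneracy in finite dimension makes contraction with `Ω` invertible, so the default value
`0` in `hamVF` is never used. -/
theorem hamVF_spec {Ω : DiffForm I M 2} (hΩ : NondegenerateForm Ω) (F : M → ℝ) (x : M)
    (w : TangentSpace I x) :
    Ω x ![hamVF Ω F x, w] = -differential I F x w := by
  have h : ∃ X : TangentSpace I x, ∀ w : TangentSpace I x,
      Ω x ![X, w] = -(mfderiv I 𝓘(ℝ, ℝ) F x w : ℝ) := by
    let p : E →L[ℝ] ℝ := -(mfderiv I 𝓘(ℝ, ℝ) F x)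
    have hi := isInvertible_curryTwoForm (E := E) (a := Ω x) (hΩ x)
    exact ⟨(curryTwoForm E (Ω x)).inverse p, fun w => (curryTwoForm_apply (E := E) _ _ w).symm.trans
      (DFunLike.congr_fun (hi.self_apply_inverse p) w)⟩
  rw [hamVF, dif_pos h]
  exact h.choose_spec w

theorem form_add_left (Ω : DiffForm I M 2) (x : M) (u u' w : TangentSpace I x) :
    Ω x ![u + u', w] = Ω x ![u, w] + Ω x ![u', w] :=
  flatForm_add_left (E := E) (Ω x) u u' w

theorem form_add_right (Ω : DiffForm I M 2) (x : M) (u w w' : TangentSpace I x) :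
    Ω x ![u, w + w'] = Ω x ![u, w] + Ω x ![u, w'] :=
  flatForm_add_right (E := E) (Ω x) u w w'

theorem form_smul_right (Ω : DiffForm I M 2) (x : M) (c : ℝ) (u w : TangentSpace I x) :
    Ω x ![u, c • w] = c * Ω x ![u, w] :=
  flatForm_smul_right (E := E) (Ω x) c u w

theorem form_self (Ω : DiffForm I M 2) (x : M) (u : TangentSpace I x) : Ω x ![u, u] = 0 :=
  (Ω x).map_eq_zero_of_eq _ (i := 0) (j := 1) rfl (by decide)

theorem form_swap (Ω : DiffForm I M 2) (x : M) (u w : TangentSpace I x) :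
    Ω x ![u, w] = -Ω x ![w, u] := by
  have h := form_self Ω x (u + w)
  rw [form_add_left, form_add_right, form_add_right, form_self, form_self] at h
  linarith

theorem differential_chartDerivSymm {F : M → ℝ} {x₀ x : M} (hF : MDifferentiableAt I 𝓘(ℝ, ℝ) F x)
    (hx : x ∈ (extChartAt I x₀).source) (u : E) :
    differential I F x (chartDerivSymm I x₀ x u) =
      fderiv ℝ (F ∘ (extChartAt I x₀).symm) (extChartAt I x₀ x) u := by
  have h := mfderiv_comp_of_eq (I := 𝓘(ℝ, E)) (I' := I) (I'' := 𝓘(ℝ, ℝ)) (x := extChartAt I x₀ x)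
    hF ((contMDiffAt_extChartAt_symm' ((extChartAt I x₀).map_source hx)).mdifferentiableAt (by simp))
    ((extChartAt I x₀).left_inv hx)
  rw [mfderiv_eq_fderiv] at h
  have key : ∀ y, y = x → ∀ v : E, (mfderiv I 𝓘(ℝ, ℝ) F y : E →L[ℝ] ℝ) v =
      (mfderiv I 𝓘(ℝ, ℝ) F x : E →L[ℝ] ℝ) v := by
    rintro _ rfl _; rfl
  exact (DFunLike.congr_fun h u).symm ▸ (key _ ((extChartAt I x₀).left_inv hx) _).symm

theorem contDiffAt_comp_chart_symm {F : M → ℝ} (hF : ContMDiff I 𝓘(ℝ, ℝ) ∞ F) {x₀ x : M}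
    (hx : x ∈ (extChartAt I x₀).source) :
    ContDiffAt ℝ ∞ (F ∘ (extChartAt I x₀).symm) (extChartAt I x₀ x) := by
  rw [← contMDiffAt_iff_contDiffAt]
  exact hF.contMDiffAt.comp _ (contMDiffAt_extChartAt_symm' ((extChartAt I x₀).map_source hx))

/-- `hamVF` is obtained by choice, so its regularity has to come from uniqueness: in coordinates it
is the solution of a linear system whose matrix and right-hand side depend continuously on the point
when `Ω` is continuous. -/
theorem chartDeriv_hamVF {Ω : DiffForm I M 2} (hΩ : NondegenerateForm Ω) {F : M → ℝ}
    (hF : ContMDiff I 𝓘(ℝ, ℝ) ∞ F) {x₀ x : M} (hx : x ∈ (extChartAt I x₀).source) :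
    (curryTwoForm E (inChart Ω x₀ (extChartAt I x₀ x))).IsInvertible ∧
    chartDeriv I x₀ x (hamVF Ω F x) =
      (curryTwoForm E (inChart Ω x₀ (extChartAt I x₀ x))).inverse
        (-fderiv ℝ (F ∘ (extChartAt I x₀).symm) (extChartAt I x₀ x)) := by
  have hi : (curryTwoForm E (inChart Ω x₀ (extChartAt I x₀ x))).IsInvertible := by
    refine isInvertible_curryTwoForm fun u hu => ?_
    have h : chartDerivSymm I x₀ x u = 0 := hΩ x _ fun w => by
      rw [two_form_apply_eq_inChart Ω hx, chartDeriv_chartDerivSymm hx, hu]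
    rw [← chartDeriv_chartDerivSymm hx u, h, map_zero]
  refine ⟨hi, ?_⟩
  have key : curryTwoForm E (inChart Ω x₀ (extChartAt I x₀ x)) (chartDeriv I x₀ x (hamVF Ω F x)) =
      -fderiv ℝ (F ∘ (extChartAt I x₀).symm) (extChartAt I x₀ x) := by
    ext u
    rw [curryTwoForm_apply, neg_apply, ← differential_chartDerivSymm
      (hF.mdifferentiableAt (by simp)) hx, ← hamVF_spec hΩ, two_form_apply_eq_inChart Ω hx,
      chartDeriv_chartDerivSymm hx]
  rw [← key, hi.inverse_apply_self]

theorem continuousAt_chartDeriv_hamVF {Ω : DiffForm I M 2} (hΩ : NondegenerateForm Ω)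
    (hc : ContinuousForm Ω) {F : M → ℝ} (hF : ContMDiff I 𝓘(ℝ, ℝ) ∞ F) (x₀ : M) :
    ContinuousAt (fun x => chartDeriv I x₀ x (hamVF Ω F x)) x₀ := by
  have hx₀ := mem_extChartAt_source (I := I) x₀
  have h1 : (fun x => chartDeriv I x₀ x (hamVF Ω F x)) =ᶠ[𝓝 x₀] fun x =>
      (curryTwoForm E (inChart Ω x₀ (extChartAt I x₀ x))).inverse
        (-fderiv ℝ (F ∘ (extChartAt I x₀).symm) (extChartAt I x₀ x)) := by
    filter_upwards [extChartAt_source_mem_nhds (I := I) x₀] with x hx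
    exact (chartDeriv_hamVF hΩ hF hx).2
  refine ContinuousAt.congr ?_ h1.symm
  have hφ : ContinuousAt (extChartAt I x₀) x₀ := continuousAt_extChartAt x₀
  have h2 : ContinuousAt (fun x => fderiv ℝ (F ∘ (extChartAt I x₀).symm) (extChartAt I x₀ x)) x₀ :=
    ContinuousAt.comp (g := fderiv ℝ (F ∘ (extChartAt I x₀).symm))
      ((contDiffAt_comp_chart_symm hF hx₀).fderiv_right (m := 0) (by simp)).continuousAt hφ
  have h3 : ContinuousAt (fun x => curryTwoForm E (inChart Ω x₀ (extChartAt I x₀ x))) x₀ :=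
    (curryTwoForm E).continuous.continuousAt.comp
      (ContinuousAt.comp (g := inChart Ω x₀) (hc.continuousAt hx₀) hφ)
  obtain ⟨e, he⟩ := (chartDeriv_hamVF hΩ hF hx₀).1
  have h4 := (contDiffAt_map_inverse (n := 0) e).continuousAt
  rw [he] at h4
  exact (ContinuousAt.comp (f := fun x => curryTwoForm E (inChart Ω x₀ (extChartAt I x₀ x)))
    h4 h3).clm_apply h2.neg

theorem differential_hamVF_self {Ω : DiffForm I M 2} (hΩ : NondegenerateForm Ω) (F : M → ℝ) (x : M) :
    differential I F x (hamVF Ω F x) = 0 := by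
  have h := hamVF_spec hΩ F x (hamVF Ω F x)
  rw [form_self] at h
  linarith

end HamiltonianVectorField

/-! ### Local bounds for norms -/

section NormedAuxiliary

theorem sqrt_bilin_self_le {G : Type*} [NormedAddCommGroup G] [NormedSpace ℝ G]
    (B : G →L[ℝ] G →L[ℝ] ℝ) (u : G) : √(B u u) ≤ √‖B‖ * ‖u‖ := by
  have h : B u u ≤ ‖B‖ * ‖u‖ ^ 2 :=
    (le_abs_self _).trans ((B.le_opNorm₂ u u).trans (le_of_eq (by ring)))
  refine (Real.sqrt_le_sqrt h).trans (le_of_eq ?_)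
  rw [Real.sqrt_mul B.opNorm_nonneg, Real.sqrt_sq (norm_nonneg _)]

theorem eventually_norm_lt {X G : Type*} [TopologicalSpace X] [NormedAddCommGroup G]
    {f : X → G} {x : X} (hf : ContinuousAt f x) : ∀ᶠ y in 𝓝 x, ‖f y‖ < ‖f x‖ + 1 :=
  hf.norm.eventually_lt continuousAt_const (lt_add_one _)

theorem eventually_norm_bilin_lt {X G : Type*} [TopologicalSpace X] [NormedAddCommGroup G]
    [NormedSpace ℝ G] {f : X → G →L[ℝ] G →L[ℝ] ℝ} {x : X} (hf : ContinuousAt f x) :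
    ∀ᶠ y in 𝓝 x, ‖f y‖ < ‖f x‖ + 1 :=
  @eventually_norm_lt X (G →L[ℝ] G →L[ℝ] ℝ) _ ContinuousLinearMap.toNormedAddCommGroup f x hf

end NormedAuxiliary

/-! ### Mechanical Hamiltonians: smoothness, fibre derivatives, compact sublevels -/

section MechanicalHamiltonian

variable {n : ℕ} {N : Type*} [TopologicalSpace N] [ChartedSpace (EuclideanSpace ℝ (Fin n)) N]
  [IsManifold (𝓡 n) ∞ N]
  (g : ContMDiffRiemannianMetric (𝓡 n) ∞ (EuclideanSpace ℝ (Fin n))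
    (fun q : N => TangentSpace (𝓡 n) q))

theorem contMDiff_mechanical {U : N → ℝ} (hU : ContMDiff (𝓡 n) 𝓘(ℝ, ℝ) ∞ U) :
    ContMDiff (coI n) 𝓘(ℝ, ℝ) ∞ (fun x : Cotangent n N => mechanical g U x.proj (momentum x)) := by
  have h : ContDiff ℝ ∞ (fun r : ℝ => r / 2) := by fun_prop
  exact (h.contMDiff.comp (contMDiff_dualNorm_sq g)).add (hU.comp contMDiff_footpoint)

theorem contMDiff_definingHamiltonian {U : N → ℝ} (hU : ContMDiff (𝓡 n) 𝓘(ℝ, ℝ) ∞ U) (k : ℝ)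
    {β : ℝ → ℝ} (hβ : ContDiff ℝ ∞ β) :
    ContMDiff (coI n) 𝓘(ℝ, ℝ) ∞ (definingHamiltonian g U k β) := by
  have h : ContDiff ℝ ∞ (fun r : ℝ => β (r - k)) := hβ.comp (by fun_prop)
  exact h.contMDiff.comp (contMDiff_mechanical g hU)

theorem continuousForm_twistedForm {σ : DiffForm (𝓡 n) N 2} (hσ : SmoothForm σ) :
    ContinuousForm (twistedForm σ) :=
  ContinuousForm.add (α := extD (liouville n N))
    (fun x₀ => smoothForm_liouville.continuousOn_inChart_extD x₀)
    (continuousForm_pullback hσ contMDiff_footpoint)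

theorem extChartAt_cotangent_snd_apply {x₀ x : Cotangent n N}
    (hx : x.proj ∈ (extChartAt (𝓡 n) x₀.proj).source) (u : EuclideanSpace ℝ (Fin n)) :
    (extChartAt (coI n) x₀ x).2 u = momentum x (chartDerivSymm (𝓡 n) x₀.proj x.proj u) := by
  rw [momentum_apply_eq_chart hx, chartDeriv_chartDerivSymm hx]

/-- The point `(q, p + s a)` of the cotangent bundle, for `x = (q, p)`. -/
def shiftMomentum (x : Cotangent n N) (a : TangentSpace (𝓡 n) x.proj →L[ℝ] ℝ) (s : ℝ) :
    Cotangent n N :=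
  ⟨x.proj, momentum x + s • a⟩

theorem chart_symm_vertical (x : Cotangent n N) (a : TangentSpace (𝓡 n) x.proj →L[ℝ] ℝ) (s : ℝ) :
    (extChartAt (coI n) x).symm (extChartAt (coI n) x x +
      s • ((0, a.comp (chartDerivSymm (𝓡 n) x.proj x.proj)) :
        EuclideanSpace ℝ (Fin n) × CoModel n)) = shiftMomentum x a s := by
  have hs : (shiftMomentum x a s).proj ∈ (extChartAt (𝓡 n) x.proj).source :=
    mem_extChartAt_source (I := 𝓡 n) x.proj
  have hx : x.proj ∈ (extChartAt (𝓡 n) x.proj).source := mem_extChartAt_source x.proj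
  have h : extChartAt (coI n) x (shiftMomentum x a s) = extChartAt (coI n) x x +
      s • ((0, a.comp (chartDerivSymm (𝓡 n) x.proj x.proj)) :
        EuclideanSpace ℝ (Fin n) × CoModel n) := by
    refine Prod.ext ?_ ?_
    · rw [extChartAt_cotangent_fst, Prod.fst_add, extChartAt_cotangent_fst]
      simp [shiftMomentum]
    · ext1 u
      rw [extChartAt_cotangent_snd_apply hs, Prod.snd_add, add_apply,
        extChartAt_cotangent_snd_apply hx]
      rfl
  rw [← h, (extChartAt (coI n) x).left_inv (mem_extChartAt_source_cotangent.2 hs)]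

/-- The horizontal part of the Hamiltonian vector field is the fibre derivative. -/
theorem covector_apply_hamVF {σ : DiffForm (𝓡 n) N 2} (hΩ : NondegenerateForm (twistedForm σ))
    {F : Cotangent n N → ℝ} (hF : ContMDiff (coI n) 𝓘(ℝ, ℝ) ∞ F) (x : Cotangent n N)
    (a : TangentSpace (𝓡 n) x.proj →L[ℝ] ℝ) {F' : ℝ}
    (hF' : HasDerivAt (fun s => F (shiftMomentum x a s)) F' 0) :
    a (mfderiv (coI n) (𝓡 n) (footpoint n N) x (hamVF (twistedForm σ) F x)) = F' := by
  have hx := mem_extChartAt_source (I := coI n) x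
  have hq := mem_extChartAt_source_cotangent.1 hx
  -- The Hamilton equation is tested on the vertical vector with momentum component `a`. Verticality
  -- kills the magnetic term `τ^*σ` and leaves only the pairing of `a` with the horizontal part of
  -- `X`.
  set V : EuclideanSpace ℝ (Fin n) × CoModel n :=
    (0, a.comp (chartDerivSymm (𝓡 n) x.proj x.proj)) with hV
  set w : TangentSpace (coI n) x := chartDerivSymm (coI n) x x V with hw
  set X := hamVF (twistedForm σ) F x with hX
  have hwV : chartDeriv (coI n) x x w = V := chartDeriv_chartDerivSymm hx V
  have hτ : mfderiv (coI n) (𝓡 n) (footpoint n N) x w = 0 := by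
    have h := extChartAt_comp_mfderiv_footpoint hx w
    rw [hwV] at h
    have h2 := chartDerivSymm_chartDeriv hq (mfderiv (coI n) (𝓡 n) (footpoint n N) x w)
    rw [h] at h2
    exact h2.symm.trans (map_zero _)
  have h1 : twistedForm σ x ![X, w] =
      -a (mfderiv (coI n) (𝓡 n) (footpoint n N) x X) := by
    have h2 : twistedForm σ x ![X, w] = extD (liouville n N) x ![X, w] +
        pullback (footpoint n N) σ x ![X, w] := rfl
    have h3 : pullback (footpoint n N) σ x ![X, w] = 0 :=
      (σ x.proj).map_coord_zero (1 : Fin 2) hτ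
    rw [h2, h3, add_zero, extD_liouville_apply hx, hwV, ← extChartAt_comp_mfderiv_footpoint hx]
    have h4 := chartDerivSymm_chartDeriv hq (mfderiv (coI n) (𝓡 n) (footpoint n N) x X)
    change (chartDeriv (coI n) x x X).2 0 - a (chartDerivSymm (𝓡 n) x.proj x.proj _) = _
    rw [map_zero, zero_sub]
    exact congrArg (fun z => -a z) h4
  have h5 := hamVF_spec hΩ F x w
  rw [← hX, h1, hw, differential_chartDerivSymm (hF.mdifferentiableAt (by simp)) hx, neg_inj] at h5
  rw [h5]
  have h6 : HasFDerivAt (F ∘ (extChartAt (coI n) x).symm)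
      (fderiv ℝ (F ∘ (extChartAt (coI n) x).symm) (extChartAt (coI n) x x))
      (extChartAt (coI n) x x + (0 : ℝ) • V) := by
    rw [zero_smul, add_zero]
    exact ((contDiffAt_comp_chart_symm hF hx).differentiableAt (by simp)).hasFDerivAt
  have h7 : HasDerivAt (fun s : ℝ => extChartAt (coI n) x x + s • V) V 0 := by
    simpa using ((hasDerivAt_id (0 : ℝ)).smul_const V).const_add (extChartAt (coI n) x x)
  have h8 := h6.comp_hasDerivAt (0 : ℝ) h7
  refine h8.unique (hF'.congr_of_eventuallyEq (Eventually.of_forall fun s => ?_))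
  exact congrArg F (chart_symm_vertical x a s)

theorem hasDerivAt_mechanical_shift (U : N → ℝ) (x : Cotangent n N)
    (a : TangentSpace (𝓡 n) x.proj →L[ℝ] ℝ) :
    HasDerivAt (fun s => mechanical g U (shiftMomentum x a s).proj (momentum (shiftMomentum x a s)))
      (a (sharp g x.proj (momentum x))) 0 := by
  have h : (fun s => mechanical g U (shiftMomentum x a s).proj (momentum (shiftMomentum x a s))) =
      fun s => (dualNorm g x.proj (momentum x) ^ 2 +
        2 * s * a (sharp g x.proj (momentum x)) + s ^ 2 * dualNorm g x.proj a ^ 2) / 2 +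
        U x.proj := by
    ext s
    rw [← dualNorm_add_smul_sq]
    rfl
  rw [h]
  have h1 : HasDerivAt (fun s : ℝ => s) 1 0 := hasDerivAt_id 0
  have := (((((h1.const_mul 2).mul_const (a (sharp g x.proj (momentum x)))).const_add
    (dualNorm g x.proj (momentum x) ^ 2)).add ((h1.pow 2).mul_const
      (dualNorm g x.proj a ^ 2))).div_const 2).add_const (U x.proj)
  refine this.congr_deriv ?_
  norm_num

/-- The Hamiltonian vector field of the defining Hamiltonian, on the region where the cut-off
function is the identity. -/
theorem covector_apply_hamVF_definingHamiltonian {σ : DiffForm (𝓡 n) N 2}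
    (hΩ : NondegenerateForm (twistedForm σ)) {U : N → ℝ} (hU : ContMDiff (𝓡 n) 𝓘(ℝ, ℝ) ∞ U)
    (k : ℝ) {β : ℝ → ℝ} (hβ : ContDiff ℝ ∞ β) (x : Cotangent n N)
    (h1 : HasDerivAt β 1 (mechanical g U x.proj (momentum x) - k))
    (a : TangentSpace (𝓡 n) x.proj →L[ℝ] ℝ) :
    a (mfderiv (coI n) (𝓡 n) (footpoint n N) x
      (hamVF (twistedForm σ) (definingHamiltonian g U k β) x)) =
      a (sharp g x.proj (momentum x)) := by
  refine covector_apply_hamVF hΩ (contMDiff_definingHamiltonian g hU k hβ) x a ?_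
  have h2 := (hasDerivAt_mechanical_shift g U x a).sub_const k
  have h3 : mechanical g U (shiftMomentum x a 0).proj (momentum (shiftMomentum x a 0)) =
      mechanical g U x.proj (momentum x) := by
    change mechanical g U x.proj (momentum x + (0 : ℝ) • a) = _
    rw [zero_smul, add_zero]
  have h4 : HasDerivAt β 1
      (mechanical g U (shiftMomentum x a 0).proj (momentum (shiftMomentum x a 0)) - k) := by
    rwa [h3]
  exact (HasDerivAt.comp (0 : ℝ) h4 h2).congr_deriv (one_mul _)

theorem eventually_norm_metricInChart_lt (q₀ : N) :
    ∀ᶠ q in 𝓝 q₀, ‖metricInChart g q₀ q‖ < ‖metricInChart g q₀ q₀‖ + 1 :=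
  eventually_norm_bilin_lt (contMDiffAt_metricInChart g q₀).continuousAt

theorem norm_extChartAt_cotangent_snd_le {x₀ x : Cotangent n N}
    (hx : x.proj ∈ (extChartAt (𝓡 n) x₀.proj).source) :
    ‖(extChartAt (coI n) x₀ x).2‖ ≤
      dualNorm g x.proj (momentum x) * √‖metricInChart g x₀.proj x.proj‖ := by
  refine ContinuousLinearMap.opNorm_le_bound _
    (mul_nonneg (dualNorm_nonneg _ _ _) (Real.sqrt_nonneg _)) fun u => ?_
  rw [extChartAt_cotangent_snd_apply hx, Real.norm_eq_abs, mul_assoc]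
  refine (abs_covector_apply_le g _ _ _).trans
    (mul_le_mul_of_nonneg_left ?_ (dualNorm_nonneg _ _ _))
  rw [← metricInChart_apply g hx]
  exact sqrt_bilin_self_le _ u

/-- Over a small chart ball of `N` the metric coefficients are bounded, so a bound on `|p|` bounds
the fibre coordinates. The set there lies in the image of a product of two closed balls, and
finitely many such neighbourhoods cover `N`. -/
theorem isCompact_dualNorm_le [CompactSpace N] (R : ℝ) :
    IsCompact {x : Cotangent n N | dualNorm g x.proj (momentum x) ^ 2 ≤ R} := by
  have hcl : IsClosed {x : Cotangent n N | dualNorm g x.proj (momentum x) ^ 2 ≤ R} :=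
    isClosed_le (contMDiff_dualNorm_sq g).continuous continuous_const
  suffices h : ∃ K : Set (Cotangent n N), IsCompact K ∧ ∀ x : Cotangent n N, x.proj ∈ univ →
      dualNorm g x.proj (momentum x) ^ 2 ≤ R → x ∈ K by
    obtain ⟨K, hK, hsub⟩ := h
    exact hK.of_isClosed_subset hcl fun x hx => hsub x (mem_univ _) hx
  refine (isCompact_univ (X := N)).induction_on (p := fun B => ∃ K : Set (Cotangent n N),
    IsCompact K ∧ ∀ x : Cotangent n N, x.proj ∈ B →
      dualNorm g x.proj (momentum x) ^ 2 ≤ R → x ∈ K) ?_ ?_ ?_ ?_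
  · exact ⟨∅, isCompact_empty, fun x hx => absurd hx (notMem_empty _)⟩
  · rintro s t hst ⟨K, hK, h⟩
    exact ⟨K, hK, fun x hx => h x (hst hx)⟩
  · rintro s t ⟨K, hK, h⟩ ⟨K', hK', h'⟩
    refine ⟨K ∪ K', hK.union hK', fun x hx hR => ?_⟩
    rcases hx with hx | hx
    · exact Or.inl (h x hx hR)
    · exact Or.inr (h' x hx hR)
  · intro q₀ _
    let x₀ : Cotangent n N := ⟨q₀, 0⟩
    have hq₀ : q₀ ∈ (extChartAt (𝓡 n) q₀).source := mem_extChartAt_source q₀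
    obtain ⟨r, hr, hball⟩ := Metric.nhds_basis_closedBall.mem_iff.1
      ((isOpen_extChartAt_target (I := 𝓡 n) q₀).mem_nhds ((extChartAt (𝓡 n) q₀).map_source hq₀))
    set ρ := √R * √(‖metricInChart g q₀ q₀‖ + 1) with hρ
    have hev : ∀ᶠ q in 𝓝 q₀, q ∈ (extChartAt (𝓡 n) q₀).source ∧
        extChartAt (𝓡 n) q₀ q ∈ Metric.closedBall (extChartAt (𝓡 n) q₀ q₀) r ∧
        ‖metricInChart g q₀ q‖ < ‖metricInChart g q₀ q₀‖ + 1 := by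
      filter_upwards [extChartAt_source_mem_nhds (I := 𝓡 n) q₀,
        (continuousAt_extChartAt (I := 𝓡 n) q₀).preimage_mem_nhds (Metric.closedBall_mem_nhds _ hr),
        eventually_norm_metricInChart_lt g q₀] with q h1 h2 h3
      exact ⟨h1, h2, h3⟩
    refine ⟨_, mem_nhdsWithin_of_mem_nhds hev, ?_⟩
    -- The target of a bundle chart contains the whole dual space over each base point of the chart:
    -- every `(y, p)` is hit by an explicit covector.
    have hT : Metric.closedBall (extChartAt (𝓡 n) q₀ q₀) r ×ˢ
        Metric.closedBall (0 : CoModel n) ρ ⊆ (extChartAt (coI n) x₀).target := by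
      rintro ⟨y, p⟩ ⟨hy, -⟩
      have hy' := hball hy
      have h1 : ∃ x : Cotangent n N, x ∈ (extChartAt (coI n) x₀).source ∧
          extChartAt (coI n) x₀ x = (y, p) := by
        have hs := (extChartAt (𝓡 n) q₀).map_target hy'
        refine ⟨⟨(extChartAt (𝓡 n) q₀).symm y,
          p.comp (chartDeriv (𝓡 n) q₀ ((extChartAt (𝓡 n) q₀).symm y))⟩,
          mem_extChartAt_source_cotangent.2 hs, Prod.ext ?_ ?_⟩
        · rw [extChartAt_cotangent_fst]
          exact (extChartAt (𝓡 n) q₀).right_inv hy'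
        · ext1 u
          rw [extChartAt_cotangent_snd_apply (x₀ := x₀) hs]
          exact congrArg p (chartDeriv_chartDerivSymm hs u)
      obtain ⟨x, hx, hxy⟩ := h1
      rw [← hxy]
      exact (extChartAt (coI n) x₀).map_source hx
    refine ⟨(extChartAt (coI n) x₀).symm '' (Metric.closedBall (extChartAt (𝓡 n) q₀ q₀) r ×ˢ
      Metric.closedBall (0 : CoModel n) ρ), ?_, ?_⟩
    · have hc : IsCompact (Metric.closedBall (0 : CoModel n) ρ) :=
        have := FiniteDimensional.proper_real (CoModel n)
        isCompact_closedBall _ _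
      exact ((isCompact_closedBall _ _).prod hc).image_of_continuousOn
        ((continuousOn_extChartAt_symm x₀).mono hT)
    · rintro x ⟨h1, h2, h3⟩ hR
      refine ⟨extChartAt (coI n) x₀ x, ⟨?_, ?_⟩,
        (extChartAt (coI n) x₀).left_inv (mem_extChartAt_source_cotangent.2 h1)⟩
      · rw [extChartAt_cotangent_fst]
        exact h2
      · rw [mem_closedBall_zero_iff]
        refine (norm_extChartAt_cotangent_snd_le g (x₀ := x₀) h1).trans ?_
        exact mul_le_mul (Real.le_sqrt_of_sq_le hR) (Real.sqrt_le_sqrt h3.le)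
          (Real.sqrt_nonneg _) (Real.sqrt_nonneg _)

theorem isCompact_mechanical_le [CompactSpace N] {U : N → ℝ} (hU : ContMDiff (𝓡 n) 𝓘(ℝ, ℝ) ∞ U)
    (R : ℝ) : IsCompact {x : Cotangent n N | mechanical g U x.proj (momentum x) ≤ R} := by
  obtain ⟨b, hb⟩ := (isCompact_range hU.continuous).bddBelow
  refine (isCompact_dualNorm_le g (2 * (R - b))).of_isClosed_subset
    (isClosed_le (contMDiff_mechanical g hU).continuous continuous_const) fun x hx => ?_
  have h1 : b ≤ U x.proj := hb (mem_range_self _)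
  have h2 : dualNorm g x.proj (momentum x) ^ 2 / 2 + U x.proj ≤ R := hx
  change dualNorm g x.proj (momentum x) ^ 2 ≤ _
  linarith

end MechanicalHamiltonian

/-! ### Comparison with the `J_t`-norms, uniform on compact sets -/

section UniformComparison

variable {E : Type*} [NormedAddCommGroup E] [NormedSpace ℝ E]
  {H : Type*} [TopologicalSpace H] {I : ModelWithCorners ℝ E H} [I.Boundaryless]
  {M : Type*} [TopologicalSpace M] [ChartedSpace H M] [IsManifold I ∞ M]

/-- A family of endomorphisms of the tangent spaces read in the chart around `x₀`. -/
def endoInChart (J : ℝ → ∀ x : M, TangentSpace I x →L[ℝ] TangentSpace I x) (x₀ : M)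
    (z : ℝ × M) : E →L[ℝ] E :=
  (chartDeriv I x₀ z.2).comp ((J z.1 z.2).comp (chartDerivSymm I x₀ z.2))

theorem endoInChart_chartDeriv (J : ℝ → ∀ x : M, TangentSpace I x →L[ℝ] TangentSpace I x)
    {x₀ : M} {z : ℝ × M} (hz : z.2 ∈ (extChartAt I x₀).source) (u : TangentSpace I z.2) :
    endoInChart J x₀ z (chartDeriv I x₀ z.2 u) = chartDeriv I x₀ z.2 (J z.1 z.2 u) := by
  change chartDeriv I x₀ z.2 (J z.1 z.2 (chartDerivSymm I x₀ z.2 (chartDeriv I x₀ z.2 u))) = _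
  rw [chartDerivSymm_chartDeriv hz]

variable {Ω : DiffForm I M 2} {J : ℝ → ∀ x : M, TangentSpace I x →L[ℝ] TangentSpace I x}

theorem IsCompatibleFamily.continuousAt_endoInChart (hJ : IsCompatibleFamily Ω J) (t₀ : ℝ)
    (x₀ : M) : ContinuousAt (endoInChart J x₀) (t₀, x₀) := by
  have h := ((contMDiffAt_hom_bundle _).1 (hJ.smooth (t₀, x₀))).2.continuousAt
  refine h.congr ?_
  have hs : ∀ᶠ z : ℝ × M in 𝓝 (t₀, x₀), z.2 ∈ (extChartAt I x₀).source :=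
    continuousAt_snd.preimage_mem_nhds (extChartAt_source_mem_nhds (I := I) x₀)
  filter_upwards [hs] with z hz
  have hz' : z.2 ∈ (chartAt H x₀).source := by rwa [extChartAt_source] at hz
  have h1 := TangentBundle.continuousLinearMapAt_trivializationAt (I := I) hz'
  have h2 := TangentBundle.symmL_trivializationAt (I := I) hz'
  rw [I.range_eq_univ, mfderivWithin_univ] at h2
  ext u
  change (trivializationAt E (TangentSpace I) x₀).continuousLinearMapAt ℝ z.2
    (J z.1 z.2 ((trivializationAt E (TangentSpace I) x₀).symmL ℝ z.2 u)) = _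
  rw [h1, h2]
  rfl

theorem form_apply_endo_eq_inChart (Ω : DiffForm I M 2)
    (J : ℝ → ∀ x : M, TangentSpace I x →L[ℝ] TangentSpace I x)
    {x₀ : M} {z : ℝ × M} (hz : z.2 ∈ (extChartAt I x₀).source) (u : TangentSpace I z.2) :
    Ω z.2 ![u, J z.1 z.2 u] = inChart Ω x₀ (extChartAt I x₀ z.2)
      ![chartDeriv I x₀ z.2 u, endoInChart J x₀ z (chartDeriv I x₀ z.2 u)] := by
  rw [endoInChart_chartDeriv J hz, two_form_apply_eq_inChart Ω hz]

theorem continuousAt_form_endo_inChart (hΩ : ContinuousForm Ω) (hJ : IsCompatibleFamily Ω J)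
    (t₀ : ℝ) (x₀ : M) (u₀ : E) :
    ContinuousAt (fun z : (ℝ × M) × E => inChart Ω x₀ (extChartAt I x₀ z.1.2)
      ![z.2, endoInChart J x₀ z.1 z.2]) ((t₀, x₀), u₀) := by
  have h1 : ContinuousAt (fun z : (ℝ × M) × E => inChart Ω x₀ (extChartAt I x₀ z.1.2))
      ((t₀, x₀), u₀) := by
    have h2 : ContinuousAt (inChart Ω x₀) (extChartAt I x₀ x₀) :=
      hΩ.continuousAt (mem_extChartAt_source x₀)
    have h3 : ContinuousAt (fun z : (ℝ × M) × E => extChartAt I x₀ z.1.2) ((t₀, x₀), u₀) :=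
      ContinuousAt.comp (g := extChartAt I x₀) (f := fun z : (ℝ × M) × E => z.1.2)
        (continuousAt_extChartAt x₀) (by fun_prop)
    exact ContinuousAt.comp (g := inChart Ω x₀) h2 h3
  refine h1.eval ?_
  rw [continuousAt_pi]
  intro i
  fin_cases i
  · exact continuousAt_snd
  · exact (ContinuousAt.comp (g := endoInChart J x₀) (f := fun z : (ℝ × M) × E => z.1)
      (hJ.continuousAt_endoInChart t₀ x₀) continuousAt_fst).clm_apply continuousAt_snd

/-- Along a continuous curve, the `J`-norm of a continuous vector field is continuous. -/
theorem IsCompatibleFamily.continuousAt_norm (hΩ : ContinuousForm Ω)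
    (hJ : IsCompatibleFamily Ω J) {c : ℝ → M} {t₀ : ℝ} (hc : ContinuousAt c t₀)
    {u : ∀ t, TangentSpace I (c t)}
    (hu : ContinuousAt (fun t => chartDeriv I (c t₀) (c t) (u t)) t₀) :
    ContinuousAt (fun t => Ω (c t) ![u t, J t (c t) (u t)]) t₀ := by
  have h1 := continuousAt_form_endo_inChart hΩ hJ t₀ (c t₀) (chartDeriv I (c t₀) (c t₀) (u t₀))
  have h2 : ContinuousAt (fun t => ((t, c t), chartDeriv I (c t₀) (c t) (u t))) t₀ :=
    (continuousAt_id.prodMk hc).prodMk hu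
  refine (ContinuousAt.comp (f := fun t => ((t, c t), chartDeriv I (c t₀) (c t) (u t)))
    h1 h2).congr ?_
  filter_upwards [hc.preimage_mem_nhds (extChartAt_source_mem_nhds (I := I) (c t₀))] with t ht
  exact (form_apply_endo_eq_inChart Ω J (z := (t, c t)) ht (u t)).symm

variable [FiniteDimensional ℝ E]

/-- Locally, the coordinate norm is dominated by the `J`-norm. -/
theorem IsCompatibleFamily.eventually_norm_sq_le (hΩ : ContinuousForm Ω)
    (hJ : IsCompatibleFamily Ω J) (t₀ : ℝ) (x₀ : M) :
    ∃ b : ℝ, 0 < b ∧ ∀ᶠ z : ℝ × M in 𝓝 (t₀, x₀), ∀ u : TangentSpace I z.2,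
      b * ‖chartDeriv I x₀ z.2 u‖ ^ 2 ≤ Ω z.2 ![u, J z.1 z.2 u] := by
  have hx₀ := mem_extChartAt_source (I := I) x₀
  have hK : IsCompact (Metric.sphere (0 : E) 1) :=
    have := FiniteDimensional.proper_real E
    isCompact_sphere _ _
  set f : (ℝ × M) × E → ℝ := fun z => inChart Ω x₀ (extChartAt I x₀ z.1.2)
      ![z.2, endoInChart J x₀ z.1 z.2] with hf
  have hpos : ∀ u ∈ Metric.sphere (0 : E) 1, 0 < f ((t₀, x₀), u) := by
    intro u hu
    have hne : chartDerivSymm I x₀ x₀ u ≠ 0 := fun h0 => by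
      have h := chartDeriv_chartDerivSymm hx₀ u
      rw [h0, map_zero] at h
      rw [← h] at hu
      simp at hu
    have h := hJ.pos t₀ x₀ _ hne
    rw [form_apply_endo_eq_inChart Ω J (z := (t₀, x₀)) hx₀, chartDeriv_chartDerivSymm hx₀] at h
    exact h
  have hcont : ContinuousOn (fun u => f ((t₀, x₀), u)) (Metric.sphere (0 : E) 1) := fun u _ =>
    (ContinuousAt.comp (g := f) (continuousAt_form_endo_inChart hΩ hJ t₀ x₀ u)
      (continuousAt_const.prodMk continuousAt_id)).continuousWithinAt
  obtain ⟨b, hb, hbf⟩ := hK.exists_forall_le' hcont hpos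
  refine ⟨b / 2, by positivity, ?_⟩
  -- Compactness of the unit sphere makes the bound uniform in the direction for all nearby `(t,
  -- x)`; half of the bound at `(t₀, x₀)` leaves room for this. Homogeneity then gives all vectors.
  have hev := hK.eventually_forall_of_forall_eventually (x₀ := (t₀, x₀))
    (P := fun z u => b / 2 < f (z, u)) fun u hu => by
      exact (continuousAt_form_endo_inChart hΩ hJ t₀ x₀ u).eventually_const_lt
        (lt_of_lt_of_le (half_lt_self hb) (hbf u hu))
  have hs : ∀ᶠ z : ℝ × M in 𝓝 (t₀, x₀), z.2 ∈ (extChartAt I x₀).source :=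
    continuousAt_snd.preimage_mem_nhds (extChartAt_source_mem_nhds (I := I) x₀)
  filter_upwards [hev, hs] with z hz hzs u
  rw [form_apply_endo_eq_inChart Ω J hzs]
  set v := chartDeriv I x₀ z.2 u with hv
  by_cases h0 : v = 0
  · rw [h0, norm_zero, map_zero]
    refine le_of_eq ?_
    rw [(inChart Ω x₀ (extChartAt I x₀ z.2)).map_coord_zero (0 : Fin 2) rfl]
    simp
  · have hn : 0 < ‖v‖ := norm_pos_iff.2 h0
    have hmem : ‖v‖⁻¹ • v ∈ Metric.sphere (0 : E) 1 := by
      rw [mem_sphere_zero_iff_norm, norm_smul, norm_inv, norm_norm, inv_mul_cancel₀ hn.ne']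
    have h1 := (hz _ hmem).le
    simp only [hf, map_smul, flatForm_smul_left, flatForm_smul_right] at h1
    rw [← mul_assoc, ← mul_inv, inv_mul_eq_div, le_div_iff₀ (by positivity)] at h1
    rw [pow_two]
    exact h1

/-- On compact sets, a locally bounded family of functionals is dominated by the `J`-norm. -/
theorem IsCompatibleFamily.exists_forall_le (hΩ : ContinuousForm Ω)
    (hJ : IsCompatibleFamily Ω J) {K : Set M} (hK : IsCompact K)
    (A : ∀ x : M, TangentSpace I x → ℝ)
    (hA : ∀ x₀, ∃ C : ℝ, ∀ᶠ x in 𝓝 x₀, ∀ u, A x u ≤ C * ‖chartDeriv I x₀ x u‖) :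
    ∃ C : ℝ, 0 ≤ C ∧ ∀ x ∈ K, ∀ t u, A x u ≤ C * √(Ω x ![u, J t x u]) := by
  have hmono : ∀ {C C' : ℝ}, C ≤ C' → ∀ {x t} {u : TangentSpace I x},
      A x u ≤ C * √(Ω x ![u, J t x u]) → A x u ≤ C' * √(Ω x ![u, J t x u]) := fun h _ _ _ h' =>
    h'.trans (mul_le_mul_of_nonneg_right h (Real.sqrt_nonneg _))
  have hcompact : IsCompact (Icc (0 : ℝ) 1 ×ˢ K) := isCompact_Icc.prod hK
  have key : ∃ C : ℝ, 0 ≤ C ∧ ∀ z ∈ Icc (0 : ℝ) 1 ×ˢ K, ∀ u : TangentSpace I z.2,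
      A z.2 u ≤ C * √(Ω z.2 ![u, J z.1 z.2 u]) := by
    refine hcompact.induction_on (p := fun S => ∃ C : ℝ, 0 ≤ C ∧ ∀ z ∈ S,
      ∀ u : TangentSpace I z.2, A z.2 u ≤ C * √(Ω z.2 ![u, J z.1 z.2 u])) ?_ ?_ ?_ ?_
    · exact ⟨0, le_rfl, fun z hz => absurd hz (notMem_empty _)⟩
    · rintro s t hst ⟨C, hC, h⟩
      exact ⟨C, hC, fun z hz => h z (hst hz)⟩
    · rintro s t ⟨C, hC, h⟩ ⟨C', hC', h'⟩
      refine ⟨max C C', hC.trans (le_max_left _ _), fun z hz u => ?_⟩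
      rcases hz with hz | hz
      · exact hmono (le_max_left _ _) (h z hz u)
      · exact hmono (le_max_right _ _) (h' z hz u)
    · rintro ⟨t₀, x₀⟩ -
      obtain ⟨b, hb, hev⟩ := hJ.eventually_norm_sq_le hΩ t₀ x₀
      obtain ⟨C, hC⟩ := hA x₀
      have hC' : ∀ᶠ z : ℝ × M in 𝓝 (t₀, x₀), ∀ u : TangentSpace I z.2,
          A z.2 u ≤ C * ‖chartDeriv I x₀ z.2 u‖ := 
        (continuous_snd.tendsto (t₀, x₀)).eventually hC
      refine ⟨_, mem_nhdsWithin_of_mem_nhds (hev.and hC'), |C| / √b, by positivity, ?_⟩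
      rintro z ⟨h1, h2⟩ u
      have h3 : √b * ‖chartDeriv I x₀ z.2 u‖ ≤ √(Ω z.2 ![u, J z.1 z.2 u]) := by
        refine Real.le_sqrt_of_sq_le ?_
        rw [mul_pow, Real.sq_sqrt hb.le]
        exact h1 u
      have hsb : 0 < √b := Real.sqrt_pos.2 hb
      calc A z.2 u ≤ C * ‖chartDeriv I x₀ z.2 u‖ := h2 u
        _ ≤ |C| * ‖chartDeriv I x₀ z.2 u‖ :=
          mul_le_mul_of_nonneg_right (le_abs_self C) (norm_nonneg _)
        _ = |C| / √b * (√b * ‖chartDeriv I x₀ z.2 u‖) := by field_simp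
        _ ≤ _ := mul_le_mul_of_nonneg_left h3 (by positivity)
  obtain ⟨C, hC, h⟩ := key
  refine ⟨C, hC, fun x hx t u => ?_⟩
  -- Periodicity reduces all times to the compact interval `[0, 1]`.
  have hper : J (Int.fract t) = J t := by
    have h1 := hJ.periodic.sub_int_mul_eq ⌊t⌋ (x := t)
    rwa [mul_one, Int.self_sub_floor] at h1
  have h1 := h (Int.fract t, x) ⟨⟨Int.fract_nonneg t, (Int.fract_lt_one t).le⟩, hx⟩ u
  simp only [hper] at h1
  exact h1

theorem eventually_abs_differential_le {F : M → ℝ} (hF : ContMDiff I 𝓘(ℝ, ℝ) ∞ F) (x₀ : M) :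
    ∃ C : ℝ, ∀ᶠ x in 𝓝 x₀, ∀ u, |differential I F x u| ≤ C * ‖chartDeriv I x₀ x u‖ := by
  have hx₀ := mem_extChartAt_source (I := I) x₀
  have h2 : ContinuousAt (fun x => fderiv ℝ (F ∘ (extChartAt I x₀).symm) (extChartAt I x₀ x)) x₀ :=
    ContinuousAt.comp (g := fderiv ℝ (F ∘ (extChartAt I x₀).symm))
      ((contDiffAt_comp_chart_symm hF hx₀).fderiv_right (m := 0) (by simp)).continuousAt
      (continuousAt_extChartAt x₀)
  refine ⟨‖fderiv ℝ (F ∘ (extChartAt I x₀).symm) (extChartAt I x₀ x₀)‖ + 1, ?_⟩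
  filter_upwards [eventually_norm_lt h2, extChartAt_source_mem_nhds (I := I) x₀] with x h3 hx u
  have h4 := differential_chartDerivSymm (hF.mdifferentiableAt (by simp)) hx (chartDeriv I x₀ x u)
  rw [chartDerivSymm_chartDeriv hx] at h4
  rw [h4]
  exact (ContinuousLinearMap.le_opNorm _ _).trans
    (mul_le_mul_of_nonneg_right h3.le (norm_nonneg _))

end UniformComparison

/-! ### Lengths of projected tangent vectors -/

section FootpointComparison

variable {n : ℕ} {N : Type*} [TopologicalSpace N] [ChartedSpace (EuclideanSpace ℝ (Fin n)) N]
  [IsManifold (𝓡 n) ∞ N]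
  (g : ContMDiffRiemannianMetric (𝓡 n) ∞ (EuclideanSpace ℝ (Fin n))
    (fun q : N => TangentSpace (𝓡 n) q))

/-- The length of the projection to `N` of a tangent vector of `T^*N`. -/
def footpointNorm (x : Cotangent n N) (u : TangentSpace (coI n) x) : ℝ :=
  √(g.inner x.proj (mfderiv (coI n) (𝓡 n) (footpoint n N) x u)
    (mfderiv (coI n) (𝓡 n) (footpoint n N) x u))

theorem eventually_footpointNorm_le (x₀ : Cotangent n N) :
    ∃ C : ℝ, ∀ᶠ x in 𝓝 x₀, ∀ u, footpointNorm g x u ≤ C * ‖chartDeriv (coI n) x₀ x u‖ := by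
  refine ⟨√(‖metricInChart g x₀.proj x₀.proj‖ + 1), ?_⟩
  have hc : ContinuousAt (footpoint n N) x₀ := contMDiff_footpoint.continuous.continuousAt
  filter_upwards [hc.eventually (eventually_norm_metricInChart_lt g x₀.proj),
    extChartAt_source_mem_nhds (I := coI n) x₀] with x h1 hx u
  have hq := mem_extChartAt_source_cotangent.1 hx
  have h2 := metricInChart_chartDeriv g hq (mfderiv (coI n) (𝓡 n) (footpoint n N) x u)
    (mfderiv (coI n) (𝓡 n) (footpoint n N) x u)
  rw [footpointNorm, ← h2, extChartAt_comp_mfderiv_footpoint hx]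
  refine (sqrt_bilin_self_le _ _).trans ?_
  exact mul_le_mul (Real.sqrt_le_sqrt h1.le) (norm_fst_le _) (norm_nonneg _) (Real.sqrt_nonneg _)

end FootpointComparison

/-! ### Lifting to the universal covering -/

section Covering

variable {n : ℕ} {N : Type*} [TopologicalSpace N] [ChartedSpace (EuclideanSpace ℝ (Fin n)) N]
  {N' : Type*} [TopologicalSpace N'] [ChartedSpace (EuclideanSpace ℝ (Fin n)) N'] {pr : N' → N}

/-- A covering map onto a path-connected base with nonempty total space is onto, since the endpoint
of a lifted path lies over the endpoint of the path. -/
theorem IsUniversalCovering.surjective [ConnectedSpace N] (hpr : IsUniversalCovering n pr) :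
    Function.Surjective pr := by
  have := hpr.simplyConnected
  have := ChartedSpace.locallyPathConnectedSpace (EuclideanSpace ℝ (Fin n)) N
  have : PathConnectedSpace N := pathConnectedSpace_iff_connectedSpace.2 inferInstance
  intro q
  obtain ⟨x₀⟩ : Nonempty N' := inferInstance
  let γ : Path (pr x₀) q := (PathConnectedSpace.joined (pr x₀) q).somePath
  obtain ⟨Γ, h1, h2⟩ := hpr.covering.exists_path_lifts (γ : C(unitInterval, N)) x₀ (by simp)
  exact ⟨Γ 1, by simpa using congrFun h1 1⟩

/-- Smooth maps from a simply connected vector space lift to smooth maps to the covering space. -/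
theorem IsUniversalCovering.exists_lift [ConnectedSpace N] (hpr : IsUniversalCovering n pr)
    {F : Type*} [NormedAddCommGroup F] [NormedSpace ℝ F] {f : F → N}
    (hf : ContMDiff 𝓘(ℝ, F) (𝓡 n) ∞ f) :
    ∃ w : F → N', ContMDiff 𝓘(ℝ, F) (𝓡 n) ∞ w ∧ pr ∘ w = f := by
  obtain ⟨x₀, hx₀⟩ := hpr.surjective (f 0)
  obtain ⟨w, ⟨-, hw⟩, -⟩ :=
    hpr.covering.existsUnique_continuousMap_lifts ⟨f, hf.continuous⟩ (0 : F) x₀ hx₀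
  refine ⟨w, fun z => ?_, hw⟩
  have hloc := hpr.localDiffeo (w z)
  -- A continuous lift is locally the smooth inverse of `pr` composed with `f`, so it inherits
  -- smoothness.
  have h1 : (w : F → N') =ᶠ[𝓝 z] hloc.localInverse ∘ f := by
    filter_upwards [w.continuous.continuousAt.eventually hloc.localInverse_eventuallyEq_left]
      with y hy
    exact hy.symm.trans (congrArg hloc.localInverse (congrFun hw y))
  have h2 : f z = pr (w z) := (congrFun hw z).symm
  refine ContMDiffAt.congr_of_eventuallyEq ?_ h1
  refine ContMDiffAt.comp z ?_ (hf z)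
  rw [h2]
  exact hloc.localInverse_contMDiffAt

/-- The covector on `N` that corresponds to a covector on the covering space computes the pullback
along lifts. -/
theorem IsUniversalCovering.exists_covector [IsManifold (𝓡 n) ∞ N]
    (hpr : IsUniversalCovering n pr)
    (g : ContMDiffRiemannianMetric (𝓡 n) ∞ (EuclideanSpace ℝ (Fin n))
      (fun q : N => TangentSpace (𝓡 n) q)) (U : N → ℝ) (θ : DiffForm (𝓡 n) N' 1)
    {F : Type*} [NormedAddCommGroup F] [NormedSpace ℝ F] {f : F → N} {w : F → N'}
    (hw : ContMDiff 𝓘(ℝ, F) (𝓡 n) ∞ w) (hwf : pr ∘ w = f) (z : F) :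
    ∃ a : TangentSpace (𝓡 n) (f z) →L[ℝ] ℝ,
      mechanical g U (f z) a = liftedMechanical g U pr (w z)
        ((ContinuousAlternatingMap.ofSubsingleton ℝ (TangentSpace (𝓡 n) (w z)) ℝ
          (0 : Fin 1)).symm (θ (w z))) ∧
      ∀ u : F, flatPullback w θ z ![u] = a (mfderiv 𝓘(ℝ, F) (𝓡 n) f z u) := by
  subst hwf
  refine ⟨_, rfl, fun u => ?_⟩
  have hloc := hpr.localDiffeo (w z)
  have h1 := mfderiv_comp z (hloc.mdifferentiableAt (by simp))
    (hw.mdifferentiableAt (x := z) (by simp))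
  have h2 : mfderiv (𝓡 n) (𝓡 n) pr (w z) =
      (hloc.mfderivToContinuousLinearEquiv (by simp) : _ →L[ℝ] _) :=
    (hloc.mfderivToContinuousLinearEquiv_coe (by simp)).symm
  have h3 : ∀ y, (mfderiv (𝓡 n) (𝓡 n) pr (w z)).inverse (mfderiv (𝓡 n) (𝓡 n) pr (w z) y) = y := by
    intro y
    rw [h2, ContinuousLinearMap.inverse_equiv]
    exact ContinuousLinearEquiv.symm_apply_apply _ _
  have h4 : (mfderiv (𝓡 n) (𝓡 n) pr (w z)).inverse (mfderiv 𝓘(ℝ, F) (𝓡 n) (pr ∘ w) z u) =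
      mfderiv 𝓘(ℝ, F) (𝓡 n) w z u :=
    (congrArg (mfderiv (𝓡 n) (𝓡 n) pr (w z)).inverse (DFunLike.congr_fun h1 u)).trans (h3 _)
  change θ (w z) (fun i => mfderiv 𝓘(ℝ, F) (𝓡 n) w z (![u] i)) =
    (ContinuousAlternatingMap.ofSubsingleton ℝ (TangentSpace (𝓡 n) (w z)) ℝ (0 : Fin 1)).symm
      (θ (w z)) ((mfderiv (𝓡 n) (𝓡 n) pr (w z)).inverse (mfderiv 𝓘(ℝ, F) (𝓡 n) (pr ∘ w) z u))
  refine Eq.trans ?_ (congrArg ((ContinuousAlternatingMap.ofSubsingleton ℝ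
    (TangentSpace (𝓡 n) (w z)) ℝ (0 : Fin 1)).symm (θ (w z))) h4).symm
  exact congrArg (θ (w z)) (funext fun i => by fin_cases i; rfl)

end Covering

/-! ### A primitive of the twisted form along a map -/

section Primitive

variable {n : ℕ} {N : Type*} [TopologicalSpace N] [ChartedSpace (EuclideanSpace ℝ (Fin n)) N]
  [IsManifold (𝓡 n) ∞ N] [ConnectedSpace N]
  {N' : Type*} [TopologicalSpace N'] [ChartedSpace (EuclideanSpace ℝ (Fin n)) N']
  [IsManifold (𝓡 n) ∞ N'] {pr : N' → N}

/-- A primitive of the pullback of the twisted symplectic form under a map from a vector space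
to `T^*N`, induced from a primitive of the lift of `σ`. -/
theorem IsUniversalCovering.exists_primitive (hpr : IsUniversalCovering n pr)
    (g : ContMDiffRiemannianMetric (𝓡 n) ∞ (EuclideanSpace ℝ (Fin n))
      (fun q : N => TangentSpace (𝓡 n) q)) {σ : DiffForm (𝓡 n) N 2} (U : N → ℝ)
    {θ : DiffForm (𝓡 n) N' 1} (hθ : SmoothForm θ) (hθσ : extD θ = pullback pr σ) {k₀ : ℝ}
    (hk₀ : ∀ x : N', liftedMechanical g U pr x
      ((ContinuousAlternatingMap.ofSubsingleton ℝ (TangentSpace (𝓡 n) x) ℝ (0 : Fin 1)).symm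
        (θ x)) ≤ k₀)
    {F : Type*} [NormedAddCommGroup F] [NormedSpace ℝ F] {f : F → Cotangent n N}
    (hf : ContMDiff 𝓘(ℝ, F) (coI n) ∞ f) :
    ∃ A : F → F [⋀^Fin 1]→L[ℝ] ℝ, Differentiable ℝ A ∧
      extDeriv A = flatPullback f (twistedForm σ) ∧
      ∀ z, ∃ a : TangentSpace (𝓡 n) (f z).proj →L[ℝ] ℝ, mechanical g U (f z).proj a ≤ k₀ ∧
        ∀ u : F, A z ![u] = (momentum (f z) + a)
          (mfderiv (coI n) (𝓡 n) (footpoint n N) (f z) (mfderiv 𝓘(ℝ, F) (coI n) f z u)) := by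
  obtain ⟨w, hw, hwf⟩ := hpr.exists_lift (contMDiff_footpoint.comp hf)
  have hfd : ∀ z, MDifferentiableAt 𝓘(ℝ, F) (coI n) f z := fun z => hf.mdifferentiableAt (by simp)
  have hfoot : ∀ x, MDifferentiableAt (coI n) (𝓡 n) (footpoint n N) x := fun x =>
    contMDiff_footpoint.mdifferentiableAt (by simp)
  -- Only the footpoint map has to be lifted: `p dq` already lives on `T^*N`, and `θ` is pulled back
  -- along the lift `w`.
  refine ⟨flatPullback f (liouville n N) + flatPullback w θ, fun z => ?_, ?_, fun z => ?_⟩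
  · exact (differentiableAt_pullback smoothForm_liouville (hf z)).add
      (differentiableAt_pullback hθ (hw z))
  · ext1 z
    refine (extDeriv_add (differentiableAt_pullback smoothForm_liouville (hf z))
      (differentiableAt_pullback hθ (hw z))).trans ?_
    rw [extDeriv_pullback_eq_pullback_extD smoothForm_liouville (hf z),
      extDeriv_pullback_eq_pullback_extD hθ (hw z), hθσ,
      flatPullback_comp σ (hpr.localDiffeo.mdifferentiable (by simp) _)
        (hw.mdifferentiableAt (by simp)), hwf]
    refine (congrArg _ (flatPullback_comp σ (hfoot _) (hfd z)).symm).trans ?_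
    rfl
  · obtain ⟨a, ha, hau⟩ := hpr.exists_covector g U θ hw hwf z
    refine ⟨a, ha.trans_le (hk₀ _), fun u => ?_⟩
    refine (congrArg (flatPullback f (liouville n N) z ![u] + ·) (hau u)).trans ?_
    exact congrArg (flatPullback f (liouville n N) z ![u] + ·)
      (congrArg a (DFunLike.congr_fun (mfderiv_comp z (hfoot _) (hfd z)) u))

end Primitive

/-! ### Derivatives of periodic maps and of slices -/

section Periodicity

variable {E : Type*} [NormedAddCommGroup E] [NormedSpace ℝ E]
  {H : Type*} [TopologicalSpace H] {I : ModelWithCorners ℝ E H}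
  {M : Type*} [TopologicalSpace M] [ChartedSpace H M]
  {F : Type*} [NormedAddCommGroup F] [NormedSpace ℝ F]
  {G : Type*} [NormedAddCommGroup G] [NormedSpace ℝ G]

/-- This is the chain rule for `z ↦ f (L z + c)`. The derivatives on the two sides lie over base
points that are only propositionally equal, so the equality is stated for an arbitrary function `Φ`
of base point and derivative. -/
theorem mfderiv_comp_affine {α : Type*} (Φ : ∀ x : M, (F →L[ℝ] TangentSpace I x) → α)
    {f : G → M} {h : F → M} (L : F →L[ℝ] G) (c : G) (hfh : ∀ z, f (L z + c) = h z) {z : F}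
    (hf : MDifferentiableAt 𝓘(ℝ, G) I f (L z + c)) :
    Φ (f (L z + c)) ((mfderiv 𝓘(ℝ, G) I f (L z + c) : G →L[ℝ] TangentSpace I (f (L z + c))).comp L)
      = Φ (h z) (mfderiv 𝓘(ℝ, F) I h z) := by
  obtain rfl : f ∘ (fun z => L z + c) = h := funext hfh
  have hd : HasFDerivAt (fun z => L z + c) L z := L.hasFDerivAt.add_const c
  have h1 := (hf.hasMFDerivAt.comp z hd.hasMFDerivAt).mfderiv
  exact congrArg (Φ (f (L z + c))) h1.symm

variable (I) in
/-- The derivative of a periodic map is periodic. -/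
theorem mfderiv_periodic {α : Type*} (Φ : ∀ x : M, TangentSpace I x → α) {f : F → M} {c : F}
    (hc : ∀ z, f (z + c) = f z) (hf : ContMDiff 𝓘(ℝ, F) I ∞ f) (z u : F) :
    Φ (f (z + c)) (mfderiv 𝓘(ℝ, F) I f (z + c) u) = Φ (f z) (mfderiv 𝓘(ℝ, F) I f z u) :=
  mfderiv_comp_affine (fun x L => Φ x (L u)) (ContinuousLinearMap.id ℝ F) c hc
    (hf.mdifferentiableAt (by simp))

/-- The derivative of a map on the plane along a horizontal line. -/
theorem mfderiv_slice {α : Type*} (Φ : ∀ x : M, TangentSpace I x → α) {f : ℝ × ℝ → M} {s : ℝ}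
    {v : ℝ → M} (hv : ∀ t, f (t, s) = v t) (hf : ContMDiff 𝓘(ℝ, ℝ × ℝ) I ∞ f) (t : ℝ) :
    Φ (f (t, s)) (mfderiv 𝓘(ℝ, ℝ × ℝ) I f (t, s) ((1, 0) : ℝ × ℝ)) = Φ (v t) (velocity I v t) := by
  have h : ∀ t, ContinuousLinearMap.inl ℝ ℝ ℝ t + (0, s) = (t, s) := fun t => by simp
  have h1 := mfderiv_comp_affine (z := t) (f := f) (h := v) (fun x L => Φ x (L (1 : ℝ)))
    (ContinuousLinearMap.inl ℝ ℝ ℝ) ((0, s) : ℝ × ℝ) (fun t => by rw [h, hv])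
    (hf.mdifferentiableAt (by simp))
  refine Eq.trans ?_ h1
  have h2 : ∀ z w : ℝ × ℝ, z = w → Φ (f z) (mfderiv 𝓘(ℝ, ℝ × ℝ) I f z ((1, 0) : ℝ × ℝ)) =
      Φ (f w) (mfderiv 𝓘(ℝ, ℝ × ℝ) I f w ((1, 0) : ℝ × ℝ)) := by
    rintro _ _ rfl
    rfl
  exact h2 _ _ (h t).symm

theorem velocity_periodic {α : Type*} (Φ : ∀ x : M, TangentSpace I x → α) {v : ℝ → M}
    (hv : IsLoop I v) : Function.Periodic (fun t => Φ (v t) (velocity I v t)) 1 := fun t =>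
  mfderiv_periodic I Φ hv.2 hv.1 t 1

end Periodicity

/-! ### Consequences of a small gradient -/

section GradientEstimates

open intervalIntegral

variable {E : Type*} [NormedAddCommGroup E] [NormedSpace ℝ E] [FiniteDimensional ℝ E]
  {H : Type*} [TopologicalSpace H] {I : ModelWithCorners ℝ E H} [I.Boundaryless]
  {M : Type*} [TopologicalSpace M] [ChartedSpace H M] [IsManifold I ∞ M]
  {Ω : DiffForm I M 2} {J : ℝ → ∀ x : M, TangentSpace I x →L[ℝ] TangentSpace I x}

/-- The pointwise length `|∂_t v - η X_F(v)|` with respect to the metric `Ω(·, J_t ·)`. -/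
def defect (Ω : DiffForm I M 2) (J : ℝ → ∀ x : M, TangentSpace I x →L[ℝ] TangentSpace I x)
    (F : M → ℝ) (v : ℝ → M) (η t : ℝ) : ℝ :=
  √(Ω (v t) ![velocity I v t - η • hamVF Ω F (v t),
    J t (v t) (velocity I v t - η • hamVF Ω F (v t))])

theorem defect_nonneg (F : M → ℝ) (v : ℝ → M) (η t : ℝ) : 0 ≤ defect Ω J F v η t :=
  Real.sqrt_nonneg _

theorem IsCompatibleFamily.form_self_nonneg (hJ : IsCompatibleFamily Ω J) (t : ℝ) (x : M)
    (u : TangentSpace I x) : 0 ≤ Ω x ![u, J t x u] := by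
  by_cases h : u = 0
  · rw [h]
    exact ((Ω x).map_coord_zero (0 : Fin 2) rfl).ge
  · exact (hJ.pos t x u h).le

theorem continuous_defect (hΩ : ContinuousForm Ω) (hJ : IsCompatibleFamily Ω J) {F : M → ℝ}
    (hF : ContMDiff I 𝓘(ℝ, ℝ) ∞ F) {v : ℝ → M} (hv : IsLoop I v) (η : ℝ) :
    Continuous (defect Ω J F v η) := by
  refine Real.continuous_sqrt.comp (continuous_iff_continuousAt.2 fun t₀ => ?_)
  refine hJ.continuousAt_norm hΩ hv.1.continuous.continuousAt ?_
  simp only [map_sub, map_smul]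
  refine (continuousAt_chartDeriv_mfderiv hv.1 (1 : ℝ)).sub (ContinuousAt.const_smul ?_ η)
  exact ContinuousAt.comp (g := fun x => chartDeriv I (v t₀) x (hamVF Ω F x))
    (continuousAt_chartDeriv_hamVF hJ.nondegenerateForm hΩ hF (v t₀)) hv.1.continuous.continuousAt

theorem periodic_defect (hJ : IsCompatibleFamily Ω J) (F : M → ℝ) {v : ℝ → M} (hv : IsLoop I v)
    (η : ℝ) : Function.Periodic (defect Ω J F v η) 1 := fun t => by
  have h := velocity_periodic (fun x w => √(Ω x ![w - η • hamVF Ω F x,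
    J (t + 1) x (w - η • hamVF Ω F x)])) hv t
  refine h.trans ?_
  simp only [hJ.periodic t]
  rfl

/-- By `J² = -1` and antisymmetry of `Ω`, each `J_t` is an isometry, so the factor `-J_t` in the
gradient does not change lengths. -/
theorem sq_gradNorm (hJ : IsCompatibleFamily Ω J) (F : M → ℝ) (v : ℝ → M) (η : ℝ) :
    gradNorm Ω J F v η ^ 2 =
      (∫ t in (0 : ℝ)..1, defect Ω J F v η t ^ 2) + (∫ t in (0 : ℝ)..1, F (v t)) ^ 2 := by
  have h : l2Inner Ω J v (gradAction Ω J F v η) (gradAction Ω J F v η) =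
      (∫ t in (0 : ℝ)..1, defect Ω J F v η t ^ 2) + (∫ t in (0 : ℝ)..1, F (v t)) ^ 2 := by
    refine congrArg₂ (· + ·) (integral_congr fun t _ => ?_) ?_
    · simp only [gradAction, defect]
      set e := velocity I v t - η • hamVF Ω F (v t)
      rw [Real.sq_sqrt (hJ.form_self_nonneg t (v t) e), map_neg, hJ.sq, neg_neg, form_swap,
        ← neg_one_smul ℝ (J t (v t) e), form_smul_right]
      ring
    · simp only [gradAction]
      ring
  rw [gradNorm, h, Real.sq_sqrt]
  exact add_nonneg (integral_nonneg zero_le_one fun t _ => sq_nonneg _) (sq_nonneg _)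

theorem abs_integral_le_gradNorm (hJ : IsCompatibleFamily Ω J) (F : M → ℝ) (v : ℝ → M) (η : ℝ) :
    |∫ t in (0 : ℝ)..1, F (v t)| ≤ gradNorm Ω J F v η := by
  refine abs_le_of_sq_le_sq ?_ (Real.sqrt_nonneg _)
  rw [sq_gradNorm hJ]
  exact le_add_of_nonneg_left (integral_nonneg zero_le_one fun t _ => sq_nonneg _)

theorem integral_defect_le (hΩ : ContinuousForm Ω) (hJ : IsCompatibleFamily Ω J) {F : M → ℝ}
    (hF : ContMDiff I 𝓘(ℝ, ℝ) ∞ F) {v : ℝ → M} (hv : IsLoop I v) {η ε : ℝ} (hε : 0 < ε)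
    (h : gradNorm Ω J F v η ≤ ε) : ∫ t in (0 : ℝ)..1, defect Ω J F v η t ≤ ε := by
  have hc := continuous_defect hΩ hJ hF hv η
  -- Young's inequality `d ≤ d² / (2ε) + ε / 2` takes the place of Cauchy–Schwarz: since `∫ d² ≤
  -- ε²`, each half contributes at most `ε / 2`.
  have h1 : ∫ t in (0 : ℝ)..1, defect Ω J F v η t ≤
      ∫ t in (0 : ℝ)..1, (defect Ω J F v η t ^ 2 / (2 * ε) + ε / 2) := by
    refine integral_mono_on zero_le_one (hc.intervalIntegrable _ _)
      (Continuous.intervalIntegrable (by fun_prop) _ _) fun t _ => ?_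
    have := sq_nonneg (defect Ω J F v η t - ε)
    field_simp
    nlinarith
  have h2 : ∫ t in (0 : ℝ)..1, defect Ω J F v η t ^ 2 ≤ ε ^ 2 := by
    refine le_trans ?_ (pow_le_pow_left₀ (Real.sqrt_nonneg _) h 2)
    rw [← gradNorm, sq_gradNorm hJ]
    exact le_add_of_nonneg_right (sq_nonneg _)
  rw [integral_add (Continuous.intervalIntegrable (by fun_prop) _ _)
    (Continuous.intervalIntegrable (by fun_prop) _ _), intervalIntegral.integral_div] at h1
  refine h1.trans ?_
  have h3 : (∫ t in (0 : ℝ)..1, defect Ω J F v η t ^ 2) / (2 * ε) ≤ ε ^ 2 / (2 * ε) :=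
    div_le_div_of_nonneg_right h2 (by positivity)
  have h4 : ε ^ 2 / (2 * ε) = ε / 2 := by field_simp
  simp
  linarith

/-- `F` is constant along its own Hamiltonian flow, so `η X_F` may be subtracted from the velocity
without changing the derivative. This makes the later oscillation bound independent of `η`. -/
theorem hasDerivAt_comp_loop {F : M → ℝ} (hF : ContMDiff I 𝓘(ℝ, ℝ) ∞ F) {v : ℝ → M}
    (hv : IsLoop I v) (hΩ : NondegenerateForm Ω) (η t : ℝ) :
    HasDerivAt (F ∘ v)
      (differential I F (v t) (velocity I v t - η • hamVF Ω F (v t))) t := by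
  have h1 := ((hF.mdifferentiableAt (by simp)).hasMFDerivAt.comp t
    ((hv.1.mdifferentiableAt (x := t) (by simp)).hasMFDerivAt)).hasFDerivAt
  have h2 : HasDerivAt (F ∘ v) (differential I F (v t) (velocity I v t)) t :=
    hasDerivAt_iff_hasFDerivAt.2 (h1.congr_fderiv (ContinuousLinearMap.ext_ring (one_smul ℝ _).symm))
  convert h2 using 1
  rw [map_sub, map_smul, differential_hamVF_self hΩ, smul_zero, sub_zero]

/-- The oscillation of `F` along a loop is controlled by the gradient. -/
theorem abs_comp_loop_le (hΩ : ContinuousForm Ω) (hJ : IsCompatibleFamily Ω J) {F : M → ℝ}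
    (hF : ContMDiff I 𝓘(ℝ, ℝ) ∞ F) {C : ℝ} (hC : 0 ≤ C)
    (hFC : ∀ x t u, |differential I F x u| ≤ C * √(Ω x ![u, J t x u]))
    {v : ℝ → M} (hv : IsLoop I v) {η ε : ℝ} (hε : 0 < ε) (h : gradNorm Ω J F v η ≤ ε) (t : ℝ) :
    |F (v t)| ≤ ε * (1 + C) := by
  have hcd := continuous_defect hΩ hJ hF hv η
  have hper : Function.Periodic (defect Ω J F v η) 1 := periodic_defect hJ F hv η
  have hder := hasDerivAt_comp_loop hF hv (hJ.nondegenerateForm) η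
  have hcF : Continuous (F ∘ v) := hF.continuous.comp hv.1.continuous
  -- Starting the period at `t` itself allows a comparison with every other point of the loop; the
  -- integrals over this period equal those over `[0, 1]`.
  have hosc : ∀ s ∈ Icc t (t + 1), F (v t) - ε * C ≤ F (v s) ∧ F (v s) ≤ F (v t) + ε * C := by
    intro s hs
    have h1 : ‖(F ∘ v) s - (F ∘ v) t‖ ≤ ∫ r in t..s, C * defect Ω J F v η r := by
      refine norm_sub_le_integral_of_norm_deriv_le_of_le hs.1 hcF.continuousOn
        (fun r _ => (hder r).differentiableAt.differentiableWithinAt) (Filter.Eventually.of_forall fun r _ => ?_)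
        ((hcd.const_mul C).intervalIntegrable _ _)
      rw [(hder r).deriv]
      exact hFC _ _ _
    have h2 : ∫ r in t..s, C * defect Ω J F v η r ≤ ∫ r in t..(t + 1), C * defect Ω J F v η r :=
      integral_mono_interval le_rfl hs.1 hs.2
        (Filter.Eventually.of_forall fun r => mul_nonneg hC (defect_nonneg _ _ _ _))
        ((hcd.const_mul C).intervalIntegrable _ _)
    have h3 : ∫ r in t..(t + 1), C * defect Ω J F v η r ≤ ε * C := by
      rw [intervalIntegral.integral_const_mul, hper.intervalIntegral_add_eq t 0, zero_add, mul_comm]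
      exact mul_le_mul_of_nonneg_right (integral_defect_le hΩ hJ hF hv hε h) hC
    have h4 := abs_le.1 (h1.trans (h2.trans h3))
    simp only [Function.comp_apply] at h4
    constructor <;> linarith
  have hmean : ∫ s in t..(t + 1), F (v s) = ∫ s in (0 : ℝ)..1, F (v s) := by
    have hp : Function.Periodic (fun s => F (v s)) 1 := fun s => by
      simp only [hv.2 s]
    rw [hp.intervalIntegral_add_eq t 0, zero_add]
  have hI := abs_le.1 ((abs_integral_le_gradNorm hJ F v η).trans h)
  rw [← hmean] at hI
  have hci : IntervalIntegrable (fun s => F (v s)) volume t (t + 1) := hcF.intervalIntegrable _ _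
  have h5 : ∫ _ in t..(t + 1), (F (v t) - ε * C) ≤ ∫ s in t..(t + 1), F (v s) :=
    integral_mono_on (by linarith) (by simp) hci fun s hs => (hosc s hs).1
  have h6 : ∫ s in t..(t + 1), F (v s) ≤ ∫ _ in t..(t + 1), (F (v t) + ε * C) :=
    integral_mono_on (by linarith) hci (by simp) fun s hs => (hosc s hs).2
  simp only [intervalIntegral.integral_const, add_sub_cancel_left, one_smul] at h5 h6
  rw [abs_le]
  constructor <;> linarith

end GradientEstimates

/-! ### Area of a cylinder by averaging over its covers -/

section CylinderEstimate

open intervalIntegral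

variable {E : Type*} [NormedAddCommGroup E] [NormedSpace ℝ E]
  {H : Type*} [TopologicalSpace H] {I : ModelWithCorners ℝ E H} [I.Boundaryless]
  {M : Type*} [TopologicalSpace M] [ChartedSpace H M] [IsManifold I ∞ M]
  {Ω : DiffForm I M 2} {v₀ v₁ : ℝ → M} {vbar : ℝ × ℝ → M} {A : ℝ × ℝ → (ℝ × ℝ) [⋀^Fin 1]→L[ℝ] ℝ}

theorem IsCylinder.periodic_nat (hv : IsCylinder I v₀ v₁ vbar) (m : ℕ) (z : ℝ × ℝ) :
    vbar (z + ((m : ℝ), 0)) = vbar z := by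
  have h : Function.Periodic (fun t => vbar (t, z.2)) 1 := fun t => hv.periodic t z.2
  have := h.nat_mul m z.1
  simpa [Prod.add_def] using this

/-- Stokes' theorem on the `m`-fold cover of a cylinder, cut open along a segment. -/
theorem IsCylinder.integral_primitive (hv : IsCylinder I v₀ v₁ vbar) (hΩ : ContinuousForm Ω)
    (hA : Differentiable ℝ A) (hext : extDeriv A = flatPullback vbar Ω) (m : ℕ) :
    m * cylinderIntegral Ω vbar =
      (∫ t in (0 : ℝ)..m, A (t, 1) ![((1, 0) : ℝ × ℝ)]) -
      (∫ t in (0 : ℝ)..m, A (t, 0) ![((1, 0) : ℝ × ℝ)]) -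
      (∫ s in (0 : ℝ)..1, A (m, s) ![((0, 1) : ℝ × ℝ)]) +
      ∫ s in (0 : ℝ)..1, A (0, s) ![((0, 1) : ℝ × ℝ)] := by
  have happ : ∀ z, extDeriv A z ![((0, 1) : ℝ × ℝ), ((1, 0) : ℝ × ℝ)] =
      Ω (vbar z) ![mfderiv 𝓘(ℝ, ℝ × ℝ) I vbar z ((0, 1) : ℝ × ℝ),
        mfderiv 𝓘(ℝ, ℝ × ℝ) I vbar z ((1, 0) : ℝ × ℝ)] := fun z => by
    rw [hext]
    exact congrArg (Ω (vbar z)) (funext fun i => by fin_cases i <;> rfl)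
  have hc : Continuous fun z => extDeriv A z ![((0, 1) : ℝ × ℝ), ((1, 0) : ℝ × ℝ)] := by
    simp_rw [happ]
    exact continuous_iff_continuousAt.2 fun z =>
      hΩ.continuousAt_apply hv.smooth.continuous.continuousAt
        (continuousAt_chartDeriv_mfderiv hv.smooth _) (continuousAt_chartDeriv_mfderiv hv.smooth _)
  rw [← integral_extDeriv_rectangle hA hc, cylinderIntegral, ← intervalIntegral.integral_const_mul]
  refine integral_congr fun s _ => ?_
  -- Although `A` itself need not be periodic, `dA` is, being the pullback of `Ω` under a periodic
  -- map. Hence the area over `[0, m]` is `m` times the area of the cylinder.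
  have hper : Function.Periodic
      (fun t => extDeriv A (t, s) ![((0, 1) : ℝ × ℝ), ((1, 0) : ℝ × ℝ)]) 1 := fun t => by
    have h := mfderiv_comp_affine (z := ((t, s) : ℝ × ℝ))
      (fun x (L : ℝ × ℝ →L[ℝ] TangentSpace I x) => Ω x ![L ((0, 1) : ℝ × ℝ), L ((1, 0) : ℝ × ℝ)])
      (ContinuousLinearMap.id ℝ (ℝ × ℝ)) ((1, 0) : ℝ × ℝ)
      (f := vbar) (h := vbar) (fun z => by simpa using hv.periodic_nat 1 z)
      (hv.smooth.mdifferentiableAt (by simp))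
    have h2 : ((t + 1, s) : ℝ × ℝ) = ContinuousLinearMap.id ℝ (ℝ × ℝ) (t, s) + (1, 0) := by simp
    simp only [happ]
    rw [h2]
    exact h
  have h3 := hper.intervalIntegral_add_zsmul_eq m 0 fun a b =>
    (hc.comp (by fun_prop : Continuous fun t : ℝ => (t, s))).intervalIntegrable a b
  simp only [zero_add, zsmul_eq_mul, Int.cast_natCast, mul_one] at h3
  refine Eq.trans ?_ h3.symm
  simp only [happ]

/-- The averaging step: a constant error disappears after division by `m → ∞`. -/
theorem le_of_forall_nat_mul_le {x y b : ℝ} (h : ∀ m : ℕ, m * x ≤ m * y + b) : x ≤ y := by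
  by_contra! hxy
  obtain ⟨m, hm⟩ := exists_nat_gt (b / (x - y))
  rw [div_lt_iff₀ (sub_pos.2 hxy)] at hm
  have := h m
  linarith

/-- If the primitive is bounded from below along `v₁` and bounded along `v₀`, then the symplectic
area of the cylinder is bounded from below. -/
theorem IsCylinder.le_abs_cylinderIntegral (hv : IsCylinder I v₀ v₁ vbar) (hΩ : ContinuousForm Ω)
    (hA : Differentiable ℝ A) (hext : extDeriv A = flatPullback vbar Ω) {ς κ C C₀ B ε : ℝ}
    (hς : |ς| = 1) {f : ℝ → ℝ} (hf : Continuous f) (hper : Function.Periodic f 1) (hC : 0 ≤ C)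
    (hfε : ∫ t in (0 : ℝ)..1, f t ≤ ε)
    (h₁ : ∀ t, κ - C * f t ≤ ς * A (t, 1) ![((1, 0) : ℝ × ℝ)])
    (h₀ : ∀ t, |A (t, 0) ![((1, 0) : ℝ × ℝ)]| ≤ C₀)
    (hB : ∀ (m : ℕ), ∀ s ∈ Icc (0 : ℝ) 1, |A (m, s) ![((0, 1) : ℝ × ℝ)]| ≤ B) :
    κ ≤ |cylinderIntegral Ω vbar| + C₀ + C * ε := by
  -- The error `2 * B` comes from the sides `t = 0` and `t = m` of the rectangle. It may depend on
  -- the cylinder, since it does not survive the limit.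
  refine le_of_forall_nat_mul_le (b := 2 * B) fun m => ?_
  have hd : ∀ u : ℝ × ℝ, Continuous fun z => A z ![u] := fun u => Differentiable.continuous
    fun z => (hA z).continuousAlternatingMap_apply (fun _ => differentiableAt_const _)
  have hline : ∀ s : ℝ, Continuous fun t : ℝ => (t, s) := fun s => by fun_prop
  have hst := hv.integral_primitive hΩ hA hext m
  have e₁ : m * κ - C * (m * ε) ≤ ς * ∫ t in (0 : ℝ)..m, A (t, 1) ![((1, 0) : ℝ × ℝ)] := by
    have h : ∫ t in (0 : ℝ)..m, (κ - C * f t) ≤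
        ∫ t in (0 : ℝ)..m, ς * A (t, 1) ![((1, 0) : ℝ × ℝ)] :=
      integral_mono_on (Nat.cast_nonneg m)
      ((continuous_const.sub (hf.const_mul C)).intervalIntegrable (0 : ℝ) m)
      ((((hd _).comp (hline 1)).const_mul ς).intervalIntegrable (0 : ℝ) m) fun t _ => h₁ t
    have h3 := hper.intervalIntegral_add_zsmul_eq m 0 fun a b => hf.intervalIntegrable a b
    simp only [zero_add, zsmul_eq_mul, Int.cast_natCast, mul_one] at h3
    rw [intervalIntegral.integral_sub intervalIntegrable_const ((hf.const_mul C).intervalIntegrable _ _),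
      intervalIntegral.integral_const_mul, intervalIntegral.integral_const, h3] at h
    simp only [intervalIntegral.integral_const_mul, sub_zero,
      smul_eq_mul] at h
    refine le_trans ?_ h
    have : C * (m * ∫ t in (0 : ℝ)..1, f t) ≤ C * (m * ε) := by gcongr
    linarith
  have e₀ : |∫ t in (0 : ℝ)..m, A (t, 0) ![((1, 0) : ℝ × ℝ)]| ≤ m * C₀ := by
    have h := norm_integral_le_of_norm_le_const (a := (0 : ℝ)) (b := m)
      (f := fun t => A (t, 0) ![((1, 0) : ℝ × ℝ)]) (C := C₀) fun t _ => h₀ t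
    rw [sub_zero, abs_of_nonneg (Nat.cast_nonneg m), mul_comm] at h
    exact h
  have es : ∀ m : ℕ, |∫ s in (0 : ℝ)..1, A (m, s) ![((0, 1) : ℝ × ℝ)]| ≤ B := fun m => by
    have h := norm_integral_le_of_norm_le_const (a := (0 : ℝ)) (b := 1)
      (f := fun s => A (m, s) ![((0, 1) : ℝ × ℝ)]) (C := B) fun s hs => hB m s (by
        rw [uIoc_of_le zero_le_one] at hs
        exact ⟨hs.1.le, hs.2⟩)
    simpa using h
  have es₀ := es 0
  rw [Nat.cast_zero] at es₀
  set X := ∫ t in (0 : ℝ)..m, A (t, 1) ![((1, 0) : ℝ × ℝ)]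
  have hX : |X| ≤ m * |cylinderIntegral Ω vbar| + m * C₀ + 2 * B := by
    have h : |(m : ℝ) * cylinderIntegral Ω vbar| = m * |cylinderIntegral Ω vbar| := by
      rw [abs_mul, Nat.abs_cast]
    rw [← h, abs_le]
    have a1 := abs_le.1 e₀
    have a2 := abs_le.1 (es m)
    have a3 := abs_le.1 es₀
    have a4 := le_abs_self ((m : ℝ) * cylinderIntegral Ω vbar)
    have a5 := neg_abs_le ((m : ℝ) * cylinderIntegral Ω vbar)
    constructor <;> linarith
  have hςX : ς * X ≤ |X| := by
    refine (le_abs_self _).trans (le_of_eq ?_)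
    rw [abs_mul, hς, one_mul]
  linarith

end CylinderEstimate

/-! ### The cut-off function near zero -/

section Cutoff

variable {ξ : ℝ} {β : ℝ → ℝ}

/-- By monotonicity, `|s| ≥ b` would force `|β s| ≥ b`, where `b ≥ 2ξ/3 > r` bounds the region on
which `β` is the identity. Thus a small value of `β` determines its argument and places it strictly
inside that region. -/
theorem IsCutoff.abs_le_and_hasDerivAt (hβ : IsCutoff ξ β) (hξ : 0 < ξ) {r s : ℝ}
    (hr : r ≤ ξ / 3) (h : |β s| ≤ r) : |s| ≤ r ∧ HasDerivAt β 1 s := by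
  have hmin : min (1 / 3) (ξ / 3) ≤ ξ / 3 := min_le_right _ _
  have hr0 : 0 ≤ r := (abs_nonneg _).trans h
  set b := ξ - min (1 / 3) (ξ / 3) with hb
  have hrb : r < b := by linarith
  have hmono : Monotone β := monotone_of_deriv_nonneg (hβ.smooth.differentiable (by simp))
    fun t => (hβ.deriv_mem t).1
  have hb0 : |b| = b := abs_of_nonneg (hr0.trans hrb.le)
  have hs : |s| < b := by
    rw [abs_lt]
    have h' := abs_le.1 h
    constructor
    · by_contra! hsb
      have h1 := hmono hsb
      rw [hβ.eq_self (-b) (by rw [abs_neg, hb0])] at h1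
      linarith
    · by_contra! hsb
      have h1 := hmono hsb
      rw [hβ.eq_self b hb0.le] at h1
      linarith
  refine ⟨by rwa [hβ.eq_self s hs.le] at h, (hasDerivAt_id s).congr_of_eventuallyEq ?_⟩
  filter_upwards [continuous_abs.continuousAt.eventually_lt continuousAt_const hs] with t ht
  exact hβ.eq_self t ht.le

end Cutoff

/-! ### Estimates for the Hamiltonian and for the primitive -/

section MechanicalEstimates

theorem functional_decompose {G : Type*} [NormedAddCommGroup G] [NormedSpace ℝ G] (T : G →L[ℝ] ℝ)
    (w u : G) (η : ℝ) : T w = T (w - η • u) + η * T u := by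
  rw [map_sub, map_smul, smul_eq_mul]
  ring

variable {n : ℕ} {N : Type*} [TopologicalSpace N] [ChartedSpace (EuclideanSpace ℝ (Fin n)) N]
  [IsManifold (𝓡 n) ∞ N]
  (g : ContMDiffRiemannianMetric (𝓡 n) ∞ (EuclideanSpace ℝ (Fin n))
    (fun q : N => TangentSpace (𝓡 n) q))

theorem exists_dualNorm_le_of_mechanical_le [CompactSpace N] {U : N → ℝ}
    (hU : ContMDiff (𝓡 n) 𝓘(ℝ, ℝ) ∞ U) (κ : ℝ) :
    ∃ R : ℝ, 0 ≤ R ∧ ∀ (q : N) (p : TangentSpace (𝓡 n) q →L[ℝ] ℝ),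
      mechanical g U q p ≤ κ → dualNorm g q p ≤ R := by
  obtain ⟨b, hb⟩ := (isCompact_range hU.continuous).bddBelow
  refine ⟨√(2 * (κ - b)), Real.sqrt_nonneg _, fun q p h => Real.le_sqrt_of_sq_le ?_⟩
  have h1 : b ≤ U q := hb (mem_range_self _)
  rw [mechanical] at h
  linarith

theorem exists_differential_definingHamiltonian_le [CompactSpace N] {U : N → ℝ}
    (hU : ContMDiff (𝓡 n) 𝓘(ℝ, ℝ) ∞ U) {k ξ : ℝ} (hξ : 0 < ξ) {β : ℝ → ℝ} (hβ : IsCutoff ξ β)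
    {Ω : DiffForm (coI n) (Cotangent n N) 2} (hΩ : ContinuousForm Ω)
    {J : ℝ → ∀ x : Cotangent n N, TangentSpace (coI n) x →L[ℝ] TangentSpace (coI n) x}
    (hJ : IsCompatibleFamily Ω J) :
    ∃ C : ℝ, 0 ≤ C ∧ ∀ x t u, |differential (coI n) (definingHamiltonian g U k β) x u| ≤
      C * √(Ω x ![u, J t x u]) := by
  obtain ⟨C, hC, h⟩ := hJ.exists_forall_le hΩ (isCompact_mechanical_le g hU (k + 2 * ξ))
    (fun x u => |differential (coI n) (definingHamiltonian g U k β) x u|)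
    (eventually_abs_differential_le (contMDiff_definingHamiltonian g hU k hβ.smooth))
  refine ⟨C, hC, fun x t u => ?_⟩
  -- On this compact sublevel the uniform comparison applies. Above it the cut-off is locally
  -- constant, because `ξ + min (1/3) (ξ/3) < 2ξ`, and the differential vanishes. Hence no control
  -- of `J` at infinity is needed.
  by_cases hx : mechanical g U x.proj (momentum x) ≤ k + 2 * ξ
  · exact h x hx t u
  · have hconst : definingHamiltonian g U k β =ᶠ[𝓝 x] fun _ => ξ := by
      filter_upwards [continuousAt_const.eventually_lt
        (contMDiff_mechanical g hU).continuous.continuousAt (not_le.1 hx)] with y hy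
      refine hβ.eq_top _ ?_
      have : min (1 / 3) (ξ / 3) ≤ ξ / 3 := min_le_right _ _
      linarith
    have h0 : differential (coI n) (definingHamiltonian g U k β) x = 0 :=
      (hconst.mfderiv_eq).trans mfderiv_const
    rw [h0, zero_apply, abs_zero]
    exact mul_nonneg hC (Real.sqrt_nonneg _)

theorem abs_add_covector_apply_le {R R' : ℝ} {x : Cotangent n N}
    {a : TangentSpace (𝓡 n) x.proj →L[ℝ] ℝ} (hp : dualNorm g x.proj (momentum x) ≤ R)
    (ha : dualNorm g x.proj a ≤ R') (u : TangentSpace (coI n) x) :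
    |(momentum x + a) (mfderiv (coI n) (𝓡 n) (footpoint n N) x u)| ≤
      (R + R') * footpointNorm g x u := by
  have h : ∀ w : TangentSpace (𝓡 n) x.proj,
      |(momentum x + a) w| ≤ (R + R') * √(g.inner x.proj w w) := fun w => by
    rw [add_apply, add_mul]
    exact (abs_add_le _ _).trans (add_le_add
      ((abs_covector_apply_le g _ _ w).trans (mul_le_mul_of_nonneg_right hp (Real.sqrt_nonneg _)))
      ((abs_covector_apply_le g _ _ w).trans (mul_le_mul_of_nonneg_right ha (Real.sqrt_nonneg _))))
  exact h _

/-- Near the energy level `k`, the momentum shifted by a covector of smaller energy grows along the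
Hamiltonian flow. -/
theorem le_covector_apply {σ : DiffForm (𝓡 n) N 2} (hΩ : NondegenerateForm (twistedForm σ))
    {U : N → ℝ} (hU : ContMDiff (𝓡 n) 𝓘(ℝ, ℝ) ∞ U) {k k₀ δ R R' η ς : ℝ} {β : ℝ → ℝ}
    (hβ : ContDiff ℝ ∞ β) {x : Cotangent n N}
    (h1 : HasDerivAt β 1 (mechanical g U x.proj (momentum x) - k))
    (hx : k₀ + δ ≤ mechanical g U x.proj (momentum x))
    {a : TangentSpace (𝓡 n) x.proj →L[ℝ] ℝ} (ha : mechanical g U x.proj a ≤ k₀)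
    (hp : dualNorm g x.proj (momentum x) ≤ R) (ha' : dualNorm g x.proj a ≤ R')
    (hς : |ς| = 1) (hςη : ς * η = |η|) (w : TangentSpace (coI n) x) :
    |η| * δ - (R + R') * footpointNorm g x
        (w - η • hamVF (twistedForm σ) (definingHamiltonian g U k β) x) ≤
      ς * (momentum x + a) (mfderiv (coI n) (𝓡 n) (footpoint n N) x w) := by
  set X := hamVF (twistedForm σ) (definingHamiltonian g U k β) x with hX
  let T : TangentSpace (coI n) x →L[ℝ] ℝ :=
    (momentum x + a).comp (mfderiv (coI n) (𝓡 n) (footpoint n N) x)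
  have e1 : δ ≤ T X := by
    have h2 : T X = (momentum x + a) (sharp g x.proj (momentum x)) :=
      covector_apply_hamVF_definingHamiltonian g hΩ hU k hβ x h1 (momentum x + a)
    rw [h2]
    refine le_trans ?_ (dualNorm_sq_sub_le g x.proj (momentum x) a)
    rw [mechanical] at hx ha
    linarith
  have e2 : |T (w - η • X)| ≤ (R + R') * footpointNorm g x (w - η • X) :=
    abs_add_covector_apply_le g hp ha' (w - η • X)
  have e3 : T w = T (w - η • X) + η * T X :=
    -- The velocity splits into the Hamiltonian part `η X`, on which the primitive grows by at least
    -- `|η| δ` after multiplication by the sign of `η`, and the defect, which is only bounded.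
    functional_decompose (G := EuclideanSpace ℝ (Fin n) × CoModel n) T w X η
  have e4 : -|T (w - η • X)| ≤ ς * T (w - η • X) := by
    refine le_trans (le_of_eq ?_) (neg_abs_le _)
    rw [abs_mul, hς, one_mul]
  change _ ≤ ς * T w
  rw [e3, mul_add, ← mul_assoc, hςη]
  have e5 := mul_le_mul_of_nonneg_left e1 (abs_nonneg η)
  linarith

theorem continuous_footpointNorm {F : Type*} [NormedAddCommGroup F] [NormedSpace ℝ F]
    {f : F → Cotangent n N} (hf : ContMDiff 𝓘(ℝ, F) (coI n) ∞ f) (u : F) :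
    Continuous fun z => footpointNorm g (f z) (mfderiv 𝓘(ℝ, F) (coI n) f z u) := by
  have hτ : ContMDiff 𝓘(ℝ, F) (𝓡 n) ∞ (footpoint n N ∘ f) := contMDiff_footpoint.comp hf
  have h1 : ∀ z, footpointNorm g (f z) (mfderiv 𝓘(ℝ, F) (coI n) f z u) =
      √(g.inner ((footpoint n N ∘ f) z) (mfderiv 𝓘(ℝ, F) (𝓡 n) (footpoint n N ∘ f) z u)
        (mfderiv 𝓘(ℝ, F) (𝓡 n) (footpoint n N ∘ f) z u)) := fun z => by
    have h2 := DFunLike.congr_fun (mfderiv_comp z (contMDiff_footpoint.mdifferentiableAt (by simp))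
      (hf.mdifferentiableAt (x := z) (by simp))) u
    exact congrArg (fun w : TangentSpace (𝓡 n) ((footpoint n N ∘ f) z) =>
      √(g.inner ((footpoint n N ∘ f) z) w w)) h2.symm
  simp_rw [h1]
  refine Real.continuous_sqrt.comp (continuous_iff_continuousAt.2 fun z₀ => ?_)
  have hc : ContinuousAt (footpoint n N ∘ f) z₀ := hτ.continuous.continuousAt
  have h3 := continuousAt_chartDeriv_mfderiv hτ (z := z₀) u
  have h4 : ContinuousAt (fun z => metricInChart g ((footpoint n N ∘ f) z₀) ((footpoint n N ∘ f) z))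
      z₀ := ContinuousAt.comp (f := footpoint n N ∘ f)
        (contMDiffAt_metricInChart g _).continuousAt hc
  refine ((h4.clm_apply h3).clm_apply h3).congr ?_
  filter_upwards [hc.preimage_mem_nhds (extChartAt_source_mem_nhds (I := 𝓡 n) _)] with z hz
  exact metricInChart_chartDeriv g hz _ _

theorem continuous_dualNorm :
    Continuous fun x : Cotangent n N => dualNorm g x.proj (momentum x) := by
  have h := Real.continuous_sqrt.comp (contMDiff_dualNorm_sq (N := N) g).continuous
  refine h.congr fun x => ?_
  exact Real.sqrt_sq (dualNorm_nonneg g _ _)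

end MechanicalEstimates

/-! ### Choice of constants and the bound on `η` -/

section MainEstimate

variable {n : ℕ} {N : Type*} [TopologicalSpace N] [ChartedSpace (EuclideanSpace ℝ (Fin n)) N]
  [IsManifold (𝓡 n) ∞ N]
  (g : ContMDiffRiemannianMetric (𝓡 n) ∞ (EuclideanSpace ℝ (Fin n))
    (fun q : N => TangentSpace (𝓡 n) q))

theorem exists_primitive_of_maneCriticalValue_lt {N' : Type*} [TopologicalSpace N']
    [ChartedSpace (EuclideanSpace ℝ (Fin n)) N'] {pr : N' → N} {σ : DiffForm (𝓡 n) N 2}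
    {U : N → ℝ} {k : ℝ} (hk : maneCriticalValue g σ U pr < (k : EReal)) :
    ∃ (θ : DiffForm (𝓡 n) N' 1) (k₀ : ℝ), k₀ < k ∧ SmoothForm θ ∧ extD θ = pullback pr σ ∧
      ∀ x : N', liftedMechanical g U pr x
        ((ContinuousAlternatingMap.ofSubsingleton ℝ (TangentSpace (𝓡 n) x) ℝ (0 : Fin 1)).symm
          (θ x)) ≤ k₀ := by
  rw [maneCriticalValue, iInf_lt_iff] at hk
  obtain ⟨θ, hθ⟩ := hk
  rw [iInf_lt_iff] at hθ
  obtain ⟨⟨hs, hd⟩, hlt⟩ := hθ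
  -- A real number strictly between the supremum for `θ` and `k`; the gap `k - k₀` drives the
  -- estimate.
  obtain ⟨k₀, h1, h2⟩ := EReal.lt_iff_exists_real_btwn.1 hlt
  exact ⟨θ, k₀, EReal.coe_lt_coe_iff.1 h2, hs, hd, fun x =>
    EReal.coe_le_coe_iff.1 ((le_iSup (fun x : N' => ((liftedMechanical g U pr x
      ((ContinuousAlternatingMap.ofSubsingleton ℝ (TangentSpace (𝓡 n) x) ℝ (0 : Fin 1)).symm
        (θ x)) : ℝ) : EReal)) x).trans h1.le)⟩

/-- The function `(|p| + R) |∂_t q|` is bounded along a loop `(q, p)`. -/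
theorem exists_bound_velocity {vref : ℝ → Cotangent n N} (hv : IsLoop (coI n) vref) (R : ℝ) :
    ∃ C : ℝ, ∀ t, (dualNorm g (vref t).proj (momentum (vref t)) + R) *
      footpointNorm g (vref t) (velocity (coI n) vref t) ≤ C := by
  have hc : Continuous fun t => (dualNorm g (vref t).proj (momentum (vref t)) + R) *
      footpointNorm g (vref t) (velocity (coI n) vref t) :=
    (((continuous_dualNorm g).comp hv.1.continuous).add continuous_const).mul
      (continuous_footpointNorm g hv.1 (1 : ℝ))
  have hp := velocity_periodic (fun (x : Cotangent n N) u =>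
    (dualNorm g x.proj (momentum x) + R) * footpointNorm g x u) hv
  obtain ⟨C, hC⟩ := (hp.compact_of_continuous one_ne_zero hc).bddAbove
  exact ⟨C, fun t => hC (mem_range_self t)⟩

/-- On a cylinder, `(|p| + R) |∂_s q|` is bounded along the segments `t = m` uniformly in `m`. -/
theorem IsCylinder.exists_bound_segment {v₀ v₁ : ℝ → Cotangent n N}
    {vbar : ℝ × ℝ → Cotangent n N} (hv : IsCylinder (coI n) v₀ v₁ vbar) (R : ℝ) :
    ∃ B : ℝ, ∀ (m : ℕ), ∀ s ∈ Icc (0 : ℝ) 1,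
      (dualNorm g (vbar (m, s)).proj (momentum (vbar (m, s))) + R) * footpointNorm g (vbar (m, s))
        (mfderiv 𝓘(ℝ, ℝ × ℝ) (coI n) vbar (m, s) ((0, 1) : ℝ × ℝ)) ≤ B := by
  have hc : Continuous fun z => (dualNorm g (vbar z).proj (momentum (vbar z)) + R) *
      footpointNorm g (vbar z) (mfderiv 𝓘(ℝ, ℝ × ℝ) (coI n) vbar z ((0, 1) : ℝ × ℝ)) :=
    (((continuous_dualNorm g).comp hv.smooth.continuous).add continuous_const).mul
      (continuous_footpointNorm g hv.smooth _)
  obtain ⟨B, hB⟩ := ((isCompact_singleton (x := (0 : ℝ))).prod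
    (isCompact_Icc (a := (0 : ℝ)) (b := 1))).bddAbove_image hc.continuousOn
  refine ⟨B, fun m s hs => ?_⟩
  have h := mfderiv_periodic (coI n) (fun (x : Cotangent n N) u =>
    (dualNorm g x.proj (momentum x) + R) * footpointNorm g x u) (hv.periodic_nat m) hv.smooth
    (0, s) (0, 1)
  have h2 : ((m, s) : ℝ × ℝ) = (0, s) + ((m : ℝ), 0) := by simp
  rw [h2]
  exact h.le.trans (hB ⟨(0, s), ⟨rfl, hs⟩, rfl⟩)

variable [CompactSpace N] [ConnectedSpace N]
  {N' : Type*} [TopologicalSpace N'] [ChartedSpace (EuclideanSpace ℝ (Fin n)) N']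
  [IsManifold (𝓡 n) ∞ N']

/-- The order of choices matters: `ε` depends only on the energy gap, `ξ` and the comparison
constant for `dH`. The reference loop enters through `C₀` alone, and the bound `B` for the given
cylinder does not enter `cbar`. -/
theorem exists_eta_bound {pr : N' → N} (hpr : IsUniversalCovering n pr)
    {σ : DiffForm (𝓡 n) N 2} (hσ : SmoothForm σ) {U : N → ℝ}
    (hU : ContMDiff (𝓡 n) 𝓘(ℝ, ℝ) ∞ U) {k : ℝ}
    (hk : maneCriticalValue g σ U pr < (k : EReal)) {ξ : ℝ} (hξ : 0 < ξ) {β : ℝ → ℝ}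
    (hβ : IsCutoff ξ β)
    {J : ℝ → ∀ x : Cotangent n N, TangentSpace (coI n) x →L[ℝ] TangentSpace (coI n) x}
    (hJ : IsCompatibleFamily (twistedForm σ) J) :
    ∃ ε : ℝ, 0 < ε ∧ ∀ vref : ℝ → Cotangent n N, IsLoop (coI n) vref → ∃ cbar : ℝ,
      ∀ (v : ℝ → Cotangent n N) (vbar : ℝ × ℝ → Cotangent n N) (η : ℝ),
        IsLoop (coI n) v → IsCylinder (coI n) vref v vbar →
        gradNorm (twistedForm σ) J (definingHamiltonian g U k β) v η ≤ ε →
        |η| ≤ cbar * (|action (twistedForm σ) (definingHamiltonian g U k β) vbar v η| + 1) := by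
  obtain ⟨θ, k₀, hk₀, hθ, hθσ, hθk⟩ := exists_primitive_of_maneCriticalValue_lt g hk
  have hΩ : ContinuousForm (twistedForm σ) := continuousForm_twistedForm hσ
  have hF : ContMDiff (coI n) 𝓘(ℝ, ℝ) ∞ (definingHamiltonian g U k β) :=
    contMDiff_definingHamiltonian g hU k hβ.smooth
  obtain ⟨C₁, hC₁, hdF⟩ := exists_differential_definingHamiltonian_le g hU (k := k) hξ hβ hΩ hJ
  obtain ⟨C₂, hC₂, hfoot⟩ := hJ.exists_forall_le hΩ (isCompact_mechanical_le g hU (k + ξ))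
    (footpointNorm g) (eventually_footpointNorm_le g)
  obtain ⟨R, hR, hRk⟩ := exists_dualNorm_le_of_mechanical_le g hU (k + ξ)
  have hak : ∀ {q : N} {a : TangentSpace (𝓡 n) q →L[ℝ] ℝ}, mechanical g U q a ≤ k₀ →
      dualNorm g q a ≤ R := fun h => hRk _ _ (by linarith)
  -- Half of the energy gap is spent on letting the loop leave `Σ_k`: energy at least `k - δ` is
  -- energy at least `k₀ + δ`.
  set δ := (k - k₀) / 2 with hδ
  have hδ0 : 0 < δ := by linarith
  -- Allowed deviation of the energy from `k`: `ξ / 3` keeps the loop where the cut-off is the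
  -- identity, `δ` keeps it above `k₀ + δ`.
  set r := min (ξ / 3) δ with hr
  have hr0 : 0 < r := lt_min (by positivity) hδ0
  have hrξ : r ≤ ξ / 3 := min_le_left _ _
  have hrδ : r ≤ δ := min_le_right _ _
  -- The first bound lets `|η| ε` be absorbed into `|η| δ` at the end; the second confines `|H ∘ v|`
  -- to at most `r`.
  set ε := min (δ / 2) (r / (1 + C₁)) with hε
  have hε0 : 0 < ε := lt_min (by positivity) (by positivity)
  have hεr : ε * (1 + C₁) ≤ r := by
    rw [← le_div_iff₀ (by positivity)]
    exact min_le_right _ _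
  refine ⟨ε, hε0, fun vref href => ?_⟩
  obtain ⟨C₀, hC₀⟩ := exists_bound_velocity g href R
  set C := (R + R) * C₂ with hC
  have hC0 : 0 ≤ C := by positivity
  refine ⟨2 / δ * (1 + |C₀| + C * ε), fun v vbar η hv hcyl hgrad => ?_⟩
  obtain ⟨A, hA, hext, hAa⟩ := hpr.exists_primitive g U hθ hθσ hθk hcyl.smooth
  obtain ⟨ς, hς, hςη⟩ : ∃ ς : ℝ, |ς| = 1 ∧ ς * η = |η| := by
    rcases le_total 0 η with h | h
    · exact ⟨1, by simp, by rw [one_mul, abs_of_nonneg h]⟩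
    · exact ⟨-1, by simp, by rw [neg_one_mul, abs_of_nonpos h]⟩
  obtain ⟨B, hB⟩ := hcyl.exists_bound_segment g R
  -- The bound involves only the cylinder in `T^*N` and not its lift, hence it is periodic even
  -- though the primitive need not be.
  have habs : ∀ z u, |A z ![u]| ≤ (dualNorm g (vbar z).proj (momentum (vbar z)) + R) *
      footpointNorm g (vbar z) (mfderiv 𝓘(ℝ, ℝ × ℝ) (coI n) vbar z u) := fun z u => by
    obtain ⟨a, ha, hau⟩ := hAa z
    rw [hau]
    exact abs_add_covector_apply_le g le_rfl (hak ha) _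
  have hend : ∀ t, |η| * δ - C * defect (twistedForm σ) J (definingHamiltonian g U k β) v η t ≤
      ς * A (t, 1) ![((1, 0) : ℝ × ℝ)] := fun t => by
    obtain ⟨a, ha, hau⟩ := hAa (t, 1)
    rw [hau]
    have hH := (abs_comp_loop_le hΩ hJ hF hC₁ hdF hv hε0 hgrad t).trans hεr
    rw [← hcyl.right t] at hH
    obtain ⟨hh, hβ1⟩ := hβ.abs_le_and_hasDerivAt hξ hrξ hH
    have hh' := abs_le.1 hh
    have hxK : mechanical g U (vbar (t, 1)).proj (momentum (vbar (t, 1))) ≤ k + ξ := by linarith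
    have h1 := le_covector_apply g hJ.nondegenerateForm hU hβ.smooth hβ1 (δ := δ) (by linarith) ha
      (hRk _ _ hxK) (hak ha) hς hςη
      (mfderiv 𝓘(ℝ, ℝ × ℝ) (coI n) vbar (t, 1) ((1, 0) : ℝ × ℝ))
    refine le_trans ?_ h1
    have h2 := hfoot _ hxK t (mfderiv 𝓘(ℝ, ℝ × ℝ) (coI n) vbar (t, 1) ((1, 0) : ℝ × ℝ) -
      η • hamVF (twistedForm σ) (definingHamiltonian g U k β) (vbar (t, 1)))
    have h3 := mfderiv_slice (fun x u => √(twistedForm σ x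
      ![u - η • hamVF (twistedForm σ) (definingHamiltonian g U k β) x,
        J t x (u - η • hamVF (twistedForm σ) (definingHamiltonian g U k β) x)]))
      hcyl.right hcyl.smooth t
    rw [h3] at h2
    have h4 := mul_le_mul_of_nonneg_left h2 (add_nonneg hR hR)
    rw [← mul_assoc] at h4
    exact sub_le_sub_left h4 _
  have hstart : ∀ t, |A (t, 0) ![((1, 0) : ℝ × ℝ)]| ≤ |C₀| := fun t => by
    refine (habs _ _).trans ?_
    have h := mfderiv_slice (fun (x : Cotangent n N) u =>
      (dualNorm g x.proj (momentum x) + R) * footpointNorm g x u) hcyl.left hcyl.smooth t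
    exact h.le.trans ((hC₀ t).trans (le_abs_self _))
  have hmain := hcyl.le_abs_cylinderIntegral hΩ hA hext hς (continuous_defect hΩ hJ hF hv η)
    (periodic_defect hJ _ hv η) hC0 (integral_defect_le hΩ hJ hF hv hε0 hgrad) hend hstart
    fun m s hs => (habs _ _).trans (hB m s hs)
  set D := cylinderIntegral (twistedForm σ) vbar with hD
  have hmean := (abs_integral_le_gradNorm hJ (definingHamiltonian g U k β) v η).trans hgrad
  set a := action (twistedForm σ) (definingHamiltonian g U k β) vbar v η with ha
  -- Area and action differ by `η ∫ H(v)`, and the mean of `H` is the second component of the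
  -- gradient.
  have hDa : |D| ≤ |a| + |η| * ε := by
    have h : D = a + η * ∫ t in (0 : ℝ)..1, definingHamiltonian g U k β (v t) := by
      rw [ha, action]
      ring
    rw [h]
    refine (abs_add_le _ _).trans (add_le_add le_rfl ?_)
    rw [abs_mul]
    exact mul_le_mul_of_nonneg_left hmean (abs_nonneg η)
  have hεδ : ε ≤ δ / 2 := min_le_left _ _
  have h5 : |η| * ε ≤ |η| * (δ / 2) := mul_le_mul_of_nonneg_left hεδ (abs_nonneg η)
  have h6 : |η| * (δ / 2) ≤ |a| + |C₀| + C * ε := by linarith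
  have h7 : |a| + |C₀| + C * ε ≤ (1 + |C₀| + C * ε) * (|a| + 1) := by
    have : 0 ≤ (|C₀| + C * ε) * |a| := by positivity
    linarith
  rw [div_mul_eq_mul_div, div_mul_eq_mul_div, le_div_iff₀ hδ0]
  linarith

end MainEstimate

end Rabinowitz

end

theorem proposition4p1 {n : ℕ}
    -- a closed connected Riemannian manifold `(N, g)`
    {N : Type*} [TopologicalSpace N] [ChartedSpace (EuclideanSpace ℝ (Fin n)) N]
    [IsManifold (𝓡 n) ∞ N] [T2Space N] [CompactSpace N] [ConnectedSpace N]
    (g : ContMDiffRiemannianMetric (𝓡 n) ∞ (EuclideanSpace ℝ (Fin n))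
      (fun q : N => TangentSpace (𝓡 n) q))
    -- its universal covering
    {N' : Type*} [TopologicalSpace N'] [ChartedSpace (EuclideanSpace ℝ (Fin n)) N']
    [IsManifold (𝓡 n) ∞ N'] (pr : N' → N) (hpr : Rabinowitz.IsUniversalCovering n pr)
    -- the magnetic field, the potential, and the energy level
    (σ : Rabinowitz.DiffForm (𝓡 n) N 2) (hσ : Rabinowitz.SmoothForm σ)
    (hσ_closed : Rabinowitz.extD σ = 0)
    (U : N → ℝ) (hU : ContMDiff (𝓡 n) 𝓘(ℝ, ℝ) ∞ U)
    (k : ℝ) (hk : Rabinowitz.maneCriticalValue g σ U pr < (k : EReal))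
    -- the cut-off function in the defining Hamiltonian
    (ξ : ℝ) (hξ : 0 < ξ) (β : ℝ → ℝ) (hβ : Rabinowitz.IsCutoff ξ β)
    -- the almost complex structures that define the `L²`-metric
    (J : ℝ → ∀ x : Rabinowitz.Cotangent n N,
      TangentSpace (Rabinowitz.coI n) x →L[ℝ] TangentSpace (Rabinowitz.coI n) x)
    (hJ : Rabinowitz.IsCompatibleFamily (Rabinowitz.twistedForm σ) J) :
    ∃ ε : ℝ, 0 < ε ∧
      -- the reference loop of a free homotopy class
      ∀ vref : ℝ → Rabinowitz.Cotangent n N, Rabinowitz.IsLoop (Rabinowitz.coI n) vref →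
      ∃ cbar : ℝ,
        ∀ (v : ℝ → Rabinowitz.Cotangent n N) (vbar : ℝ × ℝ → Rabinowitz.Cotangent n N) (η : ℝ),
          Rabinowitz.IsLoop (Rabinowitz.coI n) v →
          Rabinowitz.IsCylinder (Rabinowitz.coI n) vref v vbar →
          Rabinowitz.gradNorm (Rabinowitz.twistedForm σ) J
              (Rabinowitz.definingHamiltonian g U k β) v η ≤ ε →
          |η| ≤ cbar * (|Rabinowitz.action (Rabinowitz.twistedForm σ)
              (Rabinowitz.definingHamiltonian g U k β) vbar v η| + 1) := by
  exact Rabinowitz.exists_eta_bound g hpr hσ hU hk hξ hβ hJ
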